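/- **Buildings relayed by a given building.** A point is an element of $\mathbb R\times\mathbb R_+$. A landscape is a set $L=\{(x_i,h_i)\}$ of points (buildings, with base $x_i$ and height $h_i$; one height for each base) whose set of bases is locally finite. The blocking building $\tau(x,y)=\tau(x,y,L)$ of a point $(x,y)$ is the leftmost of the buildings $(a,b)\in L$ with $a>x$ at which the slope $\frac{b-y}{a-x}$ is maximal, whenever this maximum exists, and the blockage angle of $(x,y)$ is the arctangent of that maximal slope. The zone of eventual relaying of a building $(\alpha,\beta)$ is $Z(\alpha,\beta)=\{(x,y):\tau^{(n)}(x,y)=(\alpha,\beta)\text{ for some }n\ge 0\}$. Let $\lambda>0$, let $\mathcal L$ be a probability measure on $\mathbb R_+$ with finite mean and distribution function $F$, and let $\mathfrak F(u)=-\int_u^\infty(1-F(s))\,ds$. Let $L'$ be a deterministic landscape and $(\alpha,\beta)\in L'$ a building whose blocking building $(\alpha_b,\beta_b)$ in $L'$ exists, with blockage angle $\theta$. Let $\tilde L$ be the random landscape that coincides with $L'$ on $\{x\ge\alpha\}$ and, on $\{x<\alpha\}$, with a Poisson building process of intensity $\lambda$ and height distribution $\mathcal L$ (the points of a Poisson point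 process of intensity $\lambda$ on the line, marked by i.i.d. heights of law $\mathcal L$ independent of it). The zone $Z(\alpha,\beta)$ is taken in $\tilde L$. The reverse shade of $(\alpha,\beta)$ is the set of points $(x,y)$ such that either $x<\alpha$ and $\frac{\beta-y}{\alpha-x}\ge\tan\theta$, or $x=\alpha$ and $y\le\beta$. Let $\alpha_{sc}$ be the base of the closest building of $\tilde L$ to the left of $(\alpha,\beta)$ that is not in the reverse shade ($-\infty$ if there is none), and for $\theta\ge0$ let $\ell_\theta=\min\left(\alpha-\alpha_{sc},\frac{\beta}{\tan\theta}\right)$ be the ground length of $Z(\alpha,\beta)$, where $\beta/\tan 0=+\infty$. Then, conditionally on $Z(\alpha,\beta)$ (on the $\sigma$-algebra generated by the events $\{p\in Z(\alpha,\beta)\}$, $p\in\mathbb R\times\mathbb R_+$), the buildings of $\tilde L$ in $Z(\alpha,\beta)$ other than $(\alpha,\beta)$ itself form an inhomogeneous Poisson point process whose intensity is $\lambda\,dx\otimes\mathcal L$ restricted to $Z(\alpha,\beta)$. If $\theta>0$, their expected number and $\mathbb E[\ell_\theta]$ are finite, and the expected number equals $$\lambda\,\mathbb E[\ell_\theta]-\left(1-\exp\left(-\frac{\lambda}{\tan\theta}\bigl(\mathfrak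 F(\beta)-\mathfrak F(0)\bigr)\right)\right).$$ If $\theta=0$, this holds with the exponential replaced by $0$, in the sense that the expected number plus $1$ equals $\lambda\,\mathbb E[\ell_\theta]$ in $[0,+\infty]$. -/

import Mathlib

open MeasureTheory ProbabilityTheory
open scoped ENNReal NNReal

noncomputable section

namespace LoS

/-- Points of the half plane `ℝ × ℝ₊`. -/
abbrev Pt : Type := ℝ × ℝ≥0

/-- A landscape: a set of buildings `(x, h)` (base `x`, height `h`) whose bases form a locally
finite subset of the line.  Buildings are marked points of the line: one height for each base. -/
structure IsLandscape (L : Set Pt) : Prop where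
  finite_bases : ∀ a b : ℝ, ((Prod.fst '' L) ∩ Set.Icc a b).Finite
  injOn_base : Set.InjOn Prod.fst L

/-- The slope from `p` to `q` (the tangent of the angle that they form). -/
def incline (p q : Pt) : ℝ := ((q.2 : ℝ) - (p.2 : ℝ)) / (q.1 - p.1)

/-- The buildings of `L` to the right of `p` at which the slope from `p` is maximal. -/
def maximizers (L : Set Pt) (p : Pt) : Set Pt :=
  {q | q ∈ L ∧ p.1 < q.1 ∧ ∀ r ∈ L, p.1 < r.1 → incline p r ≤ incline p q}

/-- `q` is the blocking building `τ(p)` of `p` in `L`: the first (leftmost) of the buildings to the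
right of `p` at which the slope from `p` is maximal.  Two maximizers with the same base are equal,
so that this is the lexicographic minimum, and `q` is unique if it exists. -/
def IsBlockingBuilding (L : Set Pt) (p q : Pt) : Prop :=
  q ∈ maximizers L p ∧ ∀ r ∈ maximizers L p, q.1 ≤ r.1

/-- The zone of eventual relaying of `b`: the points `p` with `τ^(n)(p) = b` for some `n ≥ 0`. -/
def zone (L : Set Pt) (b : Pt) : Set Pt :=
  {p | Relation.ReflTransGen (IsBlockingBuilding L) p b}

/-- The blockage angle of `p`, where `q` is the blocking building of `p`. -/
def blockageAngle (p q : Pt) : ℝ := Real.arctan (incline p q)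

/-- The reverse shade of the building `b`, where `q` is the blocking building of `b`.
On the vertical line through `b` it consists of the points that are not above `b`. -/
def reverseShade (b q : Pt) : Set Pt :=
  {r | (r.1 < b.1 ∧ incline b q ≤ incline r b) ∨ (r.1 = b.1 ∧ r.2 ≤ b.2)}

/-- The base `α_sc` of the shadow-cutting building of `b` in `L` (`q` is the blocking building of
`b`), that is, of the closest building to the left of `b` that is not in the reverse shade of `b`.
It is `-∞` if there is no such building. -/
def shadowCuttingBase (L : Set Pt) (b q : Pt) : EReal :=
  sSup ((fun r : Pt => (r.1 : EReal)) '' {r | r ∈ L ∧ r.1 ≤ b.1 ∧ r ∉ reverseShade b q})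

/-- The ground length `min (α - α_sc) (β / tan θ)` of the zone of `b = (α, β)` (`q` is the blocking
building of `b` and `θ ≥ 0` its blockage angle), where `β / tan 0 = ∞`. -/
def groundLength (L : Set Pt) (b q : Pt) : ℝ≥0∞ :=
  min ((b.1 : EReal) - shadowCuttingBase L b q).toENNReal
    (if blockageAngle b q = 0 then ⊤
      else ENNReal.ofReal ((b.2 : ℝ) / Real.tan (blockageAngle b q)))

/-- The landscape that is `L'` on `{x ≥ α}` and `L` on `{x < α}`. -/
def splice (L' L : Set Pt) (α : ℝ) : Set Pt :=
  {p | p ∈ L' ∧ α ≤ p.1} ∪ {p | p ∈ L ∧ p.1 < α}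

/-- The probability that a Poisson variable of mean `r ∈ [0, ∞]` equals the natural number `n`;
a Poisson variable of mean `∞` is infinite almost surely. -/
def poissonProb (r : ℝ≥0∞) (n : ℕ) : ℝ :=
  if r = ⊤ then 0 else (poissonMeasure r.toNNReal).real {n}

section Poisson

variable {Ω E : Type*} [MeasurableSpace Ω] [MeasurableSpace E]

/-- The random set `Φ` is a Poisson point process with (diffuse) intensity measure `Λ`: the numbers
of points in disjoint measurable sets `B i` are independent Poisson variables of means `Λ (B i)`. -/
structure IsPoissonProcess (P : Measure Ω) (Λ : Measure E) (Φ : Ω → Set E) : Prop where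
  measurable_count : ∀ B : Set E, MeasurableSet B → Measurable fun ω => (Φ ω ∩ B).encard
  prob_count : ∀ (k : ℕ) (B : Fin k → Set E) (n : Fin k → ℕ),
    (∀ i, MeasurableSet (B i)) → Pairwise (Function.onFun Disjoint B) →
    P.real {ω | ∀ i, (Φ ω ∩ B i).encard = n i} = ∏ i, poissonProb (Λ (B i)) (n i)

/-- Conditionally on the σ-algebra `m`, the random set `Φ` is a Poisson point process whose
intensity measure is the random measure `Λ`: given `m`, the numbers of points in disjoint
measurable sets `B i` are independent Poisson variables of means `Λ ω (B i)`. -/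
structure IsCondPoissonProcess (P : Measure Ω) (m : MeasurableSpace Ω) (Λ : Ω → Measure E)
    (Φ : Ω → Set E) : Prop where
  le : m ≤ ‹MeasurableSpace Ω›
  aemeasurable_count : ∀ B : Set E, MeasurableSet B → AEMeasurable (fun ω => (Φ ω ∩ B).encard) P
  condProb_count : ∀ (k : ℕ) (B : Fin k → Set E) (n : Fin k → ℕ),
    (∀ i, MeasurableSet (B i)) → Pairwise (Function.onFun Disjoint B) →
    P[Set.indicator {ω | ∀ i, (Φ ω ∩ B i).encard = n i} (fun _ => (1 : ℝ)) | m]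
      =ᵐ[P] fun ω => ∏ i, poissonProb (Λ ω (B i)) (n i)

/-- `L` is a Poisson building process of intensity `lam` and height distribution `law`: a Poisson
point process `{X n}` on the line with intensity `lam`, marked with i.i.d. heights `H n` of law
`law` that are independent of the `X n`. -/
def IsPoissonBuildingProcess (P : Measure Ω) (lam : ℝ) (law : Measure ℝ≥0)
    (L : Ω → Set Pt) : Prop :=
  ∃ (X : ℕ → Ω → ℝ) (H : ℕ → Ω → ℝ≥0),
    (∀ n, Measurable (X n)) ∧ (∀ n, Measurable (H n)) ∧
    (∀ᵐ ω ∂P, Function.Injective fun n => X n ω) ∧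
    IsPoissonProcess P (ENNReal.ofReal lam • (volume : Measure ℝ))
      (fun ω => Set.range fun n => X n ω) ∧
    (∀ n, P.map (H n) = law) ∧
    iIndepFun H P ∧
    IndepFun (fun ω n => X n ω) (fun ω n => H n ω) P ∧
    ∀ ω, L ω = Set.range fun n => (X n ω, H n ω)

end Poisson

/-- The σ-algebra generated by a random subset `Z` of the half plane, that is, by the events
`{p ∈ Z}` for the points `p`. -/
abbrev sigmaOf {Ω : Type*} (Z : Ω → Set Pt) : MeasurableSpace Ω :=
  MeasurableSpace.generateFrom {A | ∃ p : Pt, A = {ω | p ∈ Z ω}}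

/-- The intensity `lam dx ⊗ law` on the half plane. -/
def intensity (lam : ℝ) (law : Measure ℝ≥0) : Measure Pt :=
  (ENNReal.ofReal lam • (volume : Measure ℝ)).prod law

/-- The cumulative distribution function of the height distribution. -/
def heightCDF (law : Measure ℝ≥0) (u : ℝ) : ℝ := law.real {h | (h : ℝ) ≤ u}

/-- The primitive of `1 - F` that tends to zero at `+∞`. -/
def primitiveTail (law : Measure ℝ≥0) (u : ℝ) : ℝ := -∫ s in Set.Ioi u, (1 - heightCDF law s)

/-- The buildings of `L` that are eventually relayed by `b`, other than `b` itself. -/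
def relayedBuildings (L : Set Pt) (b : Pt) : Set Pt := (L ∩ zone L b) \ {b}

end LoS

end

/-! Write b = (α, β) and let t = tan θ be the slope from b to its blocking building q. A point p ≠ b
is eventually relayed by b exactly when it lies to the left of b, sees b under a slope at least t,
and no building strictly between p and b rises above the line of slope t through b (`zone_subset`,
`mem_zone_of_forall_mem_shadeLeft`, combined in `mem_zone_splice_iff`). That line splits the open
half plane left of b into `shadeLeft` and `aboveLeft`. The zone is determined by one level, the
supremum of the bases of the buildings in `aboveLeft`, and the relayed buildings are the points of
the process in `shadeLeft` at or to the right of this level.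

A Poisson process is independent on disjoint sets, so the points in the shade are independent of the
level. The building process is Poisson on the half plane by the marking theorem
`measure_forall_hits_eq`, proved with generating functionals. Independence at a fixed level is
carried over to the random level by approximating the level from below by simple functions
(`HasPoissonHits.lintegral_countEvent_comp`), and then to conditional probabilities
(`HasPoissonHits.condExp_countEvent_record`). The zone need not reveal the level exactly, since a
level to the left of the foot of the shade leaves no trace; but it does reveal the part of the shade
beyond the level up to a null set (`intensity_zoneLevel`).

For the means, let w(x) be the probability that a building with base x is above the line. The
probability that the level is at most x is exp(-λ∫_x^α w), by the void probability. Fubini writes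
𝔼[ℓ_θ] as the integral of this function over the bases of the shade, and the mean number of relayed
buildings as λ times the integral of the same function weighted by 1 - w. The difference, λ∫ w(x)
exp(-λ∫_x^α w) dx, integrates a derivative: it is the probability 1 - exp(-λ∫ w) that the zone is
cut. A linear substitution turns ∫ w into (𝔉(β) - 𝔉(0)) / tan θ. For θ = 0, w is a constant; if it
is positive the cut is almost sure, and if it is zero both means are infinite. -/

noncomputable section

namespace LoS

open Filter Topology

/-! ### Generating functions of counts with values in `ℕ∞` -/

/-- Truncated power: `z ^ m` for finite `m`, and `0` for `m = ⊤` (the limit for `z < 1`). -/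
def powENat (z : ℝ≥0∞) (m : ℕ∞) : ℝ≥0∞ := ∑' n : ℕ, z ^ n * (if m = n then 1 else 0)

@[simp] lemma powENat_coe (z : ℝ≥0∞) (n : ℕ) : powENat z n = z ^ n := by
  unfold powENat
  rw [tsum_eq_single n]
  · simp
  · intro m hm
    have : (n : ℕ∞) ≠ m := by exact_mod_cast hm.symm
    simp [this]

@[simp] lemma powENat_top (z : ℝ≥0∞) : powENat z ⊤ = 0 := by
  simp [powENat]

lemma tsum_eq_zero_add_mul (A : ℕ → ℝ≥0∞) (z : ℝ≥0∞) :
    ∑' n, A n * z ^ n = A 0 + z * ∑' n, A (n + 1) * z ^ n := by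
  rw [tsum_eq_zero_add' ENNReal.summable, ← ENNReal.tsum_mul_left]
  simp only [pow_zero, mul_one, pow_succ]
  congr 2
  ext n
  ring

lemma coeff_zero_le_of_tsum_eq (A C : ℕ → ℝ≥0∞) (hC : ∀ n, C n ≤ 1)
    (h : ∀ z : ℝ≥0∞, 0 < z → z < 1 → ∑' n, A n * z ^ n = ∑' n, C n * z ^ n) : A 0 ≤ C 0 := by
  refine ENNReal.le_of_forall_pos_le_add fun ε hε _ => ?_
  -- The bound 1/2 makes the remaining series at most a geometric series of sum 2, and ε / 2 makes
  -- its contribution z * 2 at most ε.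
  set z : ℝ≥0 := min (ε / 2) 2⁻¹ with hz
  have hz0 : 0 < z := by rw [hz]; positivity
  have hz2 : z ≤ 2⁻¹ := min_le_right _ _
  have hz1 : z < 1 := lt_of_le_of_lt hz2 (by
    rw [← NNReal.coe_lt_coe]; norm_num)
  have hbound : ∑' n, C (n + 1) * (z : ℝ≥0∞) ^ n ≤ 2 := by
    calc ∑' n, C (n + 1) * (z : ℝ≥0∞) ^ n ≤ ∑' n, (2⁻¹ : ℝ≥0∞) ^ n := by
          refine ENNReal.tsum_le_tsum fun n => ?_
          refine (mul_le_of_le_one_left' (hC _)).trans ?_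
          gcongr
          have : ((2⁻¹ : ℝ≥0) : ℝ≥0∞) = 2⁻¹ := by simp
          rw [← this]
          exact_mod_cast hz2
      _ = 2 := by rw [ENNReal.tsum_geometric]; simp
  calc A 0 ≤ ∑' n, A n * (z : ℝ≥0∞) ^ n := by
        rw [tsum_eq_zero_add_mul]; exact le_self_add
    _ = C 0 + z * ∑' n, C (n + 1) * (z : ℝ≥0∞) ^ n := by
        rw [h z (by exact_mod_cast hz0) (by exact_mod_cast hz1), tsum_eq_zero_add_mul]
    _ ≤ C 0 + z * 2 := by gcongr
    _ ≤ C 0 + ε := by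
        gcongr
        have : z * 2 ≤ ε := by
          calc z * 2 ≤ ε / 2 * 2 := by gcongr; exact min_le_left _ _
            _ = ε := by field_simp
        exact_mod_cast this

/-- Uniqueness of the coefficients of a power series with bounded coefficients. -/
lemma coeff_eq_of_tsum_eq (n : ℕ) : ∀ (A C : ℕ → ℝ≥0∞) (_ : ∀ n, A n ≤ 1) (_ : ∀ n, C n ≤ 1)
    (_ : ∀ z : ℝ≥0∞, 0 < z → z < 1 → ∑' n, A n * z ^ n = ∑' n, C n * z ^ n), A n = C n := by
  induction n with
  | zero =>
    intro A C hA hC h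
    exact le_antisymm (coeff_zero_le_of_tsum_eq A C hC h)
      (coeff_zero_le_of_tsum_eq C A hA fun z h0 h1 => (h z h0 h1).symm)
  | succ n ih =>
    intro A C hA hC h
    have h0 : A 0 = C 0 := le_antisymm (coeff_zero_le_of_tsum_eq A C hC h)
      (coeff_zero_le_of_tsum_eq C A hA fun z h0 h1 => (h z h0 h1).symm)
    -- Equal finite constant terms cancel, and division by z > 0 leaves the same identity for the
    -- shifted coefficients.
    refine ih (fun n => A (n + 1)) (fun n => C (n + 1)) (fun n => hA _) (fun n => hC _) ?_
    intro z hz0 hz1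
    have hz := h z hz0 hz1
    rw [tsum_eq_zero_add_mul, tsum_eq_zero_add_mul C, h0] at hz
    have hC0 : C 0 ≠ ⊤ := ne_top_of_le_ne_top ENNReal.one_ne_top (hC 0)
    have := (ENNReal.add_right_inj hC0).mp hz
    exact (ENNReal.mul_right_inj hz0.ne' (ne_top_of_lt hz1)).mp this

section PGF

variable {Ω : Type*} [MeasurableSpace Ω] {ι : Type*}

lemma measurable_powENat (z : ℝ≥0∞) : Measurable (powENat z) := Measurable.of_discrete

lemma lintegral_powENat_mul (P : Measure Ω) (M : Ω → ℕ∞) (hM : Measurable M) (F : Ω → ℝ≥0∞)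
    (hF : Measurable F) (z : ℝ≥0∞) :
    ∫⁻ ω, powENat z (M ω) * F ω ∂P
      = ∑' n : ℕ, (∫⁻ ω, (if M ω = n then 1 else 0) * F ω ∂P) * z ^ n := by
  have h1 : ∀ n : ℕ, Measurable fun ω => (if M ω = n then (1 : ℝ≥0∞) else 0) := fun n =>
    (Measurable.of_discrete (f := fun m : ℕ∞ => (if m = n then (1 : ℝ≥0∞) else 0))).comp hM
  simp_rw [powENat, ← ENNReal.tsum_mul_right]
  rw [lintegral_tsum (f := fun (n : ℕ) ω => (z ^ n * if M ω = n then 1 else 0) * F ω)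
    fun n => ((measurable_const.mul (h1 n)).mul hF).aemeasurable]
  congr 1
  ext n
  rw [← lintegral_mul_const _ (f := fun ω => (if M ω = n then 1 else 0) * F ω) ((h1 n).mul hF)]
  congr 1
  ext ω
  ring

open Classical in
/-- The mixed functional: generating functions for the indices in `S`, indicators for the others. -/
def mixedFactor (M : ι → Ω → ℕ∞) (z : ι → ℝ≥0∞) (n : ι → ℕ) (S : Set ι)
    (i : ι) (ω : Ω) : ℝ≥0∞ :=
  if i ∈ S then powENat (z i) (M i ω) else if M i ω = n i then 1 else 0

lemma measurable_mixedFactor (M : ι → Ω → ℕ∞) (hM : ∀ i, Measurable (M i)) (z : ι → ℝ≥0∞)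
    (n : ι → ℕ) (S : Set ι) (i : ι) :
    Measurable (mixedFactor M z n S i) := by
  unfold mixedFactor
  by_cases h : i ∈ S
  · simp only [h, if_true]
    exact (measurable_powENat (z i)).comp (hM i)
  · simp only [h, if_false]
    exact (Measurable.of_discrete
      (f := fun m : ℕ∞ => (if m = n i then (1 : ℝ≥0∞) else 0))).comp (hM i)

variable [Fintype ι]

open Classical in
lemma prod_eq_mul_prod_erase_of_eq {f g : ι → ℝ≥0∞} (j : ι) (h : ∀ i, i ≠ j → f i = g i) :
    ∏ i, f i = f j * ∏ i ∈ Finset.univ.erase j, g i := by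
  rw [← Finset.mul_prod_erase _ _ (Finset.mem_univ j)]
  congr 1
  exact Finset.prod_congr rfl fun i hi => h i (Finset.ne_of_mem_erase hi)

open Classical in
-- The indicators are traded for powers one index at a time, by summing the identity for the other
-- indices over the value of one count. The event of an infinite count contributes nothing, so the
-- coefficients need not sum to 1; this covers Poisson counts of infinite mean.
theorem lintegral_prod_powENat (P : Measure Ω) (M : ι → Ω → ℕ∞) (hM : ∀ i, Measurable (M i))
    (c : ι → ℕ → ℝ≥0∞)
    (h : ∀ n : ι → ℕ, P {ω | ∀ i, M i ω = n i} = ∏ i, c i (n i)) (z : ι → ℝ≥0∞) :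
    ∫⁻ ω, ∏ i, powENat (z i) (M i ω) ∂P = ∏ i, ∑' n, c i n * z i ^ n := by
  have key : ∀ S : Finset ι, ∀ n : ι → ℕ,
      ∫⁻ ω, ∏ i, mixedFactor M z n (S : Set ι) i ω ∂P
        = ∏ i, if i ∈ S then ∑' n, c i n * z i ^ n else c i (n i) := by
    intro S
    induction S using Finset.induction_on with
    | empty =>
      intro n
      simp only [Finset.notMem_empty, if_false, ← h n]
      rw [← lintegral_indicator_one]
      · congr 1
        ext ω
        by_cases hω : ∀ i, M i ω = n i
        · simp [mixedFactor, hω]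
        · have : ω ∉ {ω | ∀ i, M i ω = n i} := hω
          rw [Set.indicator_of_notMem this]
          push Not at hω
          obtain ⟨i, hi⟩ := hω
          exact Finset.prod_eq_zero (Finset.mem_univ i) (by simp [mixedFactor, hi])
      · simp only [Set.ofPred_forall]
        exact MeasurableSet.iInter fun i => hM i (measurableSet_singleton _)
    | insert j S hj ih =>
      intro n
      have e1 : ∀ ω, ∏ i, mixedFactor M z n ((insert j S : Finset ι) : Set ι) i ω
          = powENat (z j) (M j ω) *
            ∏ i ∈ Finset.univ.erase j, mixedFactor M z n (S : Set ι) i ω := by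
        intro ω
        rw [prod_eq_mul_prod_erase_of_eq j (g := fun i => mixedFactor M z n (S : Set ι) i ω)]
        · simp [mixedFactor]
        · intro i hi
          simp [mixedFactor, hi]
      simp_rw [e1]
      rw [lintegral_powENat_mul P _ (hM j) _
        (Finset.measurable_prod _ fun i _ => measurable_mixedFactor M hM z n _ i)]
      have e2 : ∀ m : ℕ, ∫⁻ ω, (if M j ω = m then 1 else 0) *
            ∏ i ∈ Finset.univ.erase j, mixedFactor M z n (S : Set ι) i ω ∂P
          = c j m * ∏ i ∈ Finset.univ.erase j,
            if i ∈ S then ∑' n, c i n * z i ^ n else c i (n i) := by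
        intro m
        -- The coefficient of `z j ^ m` is the induction hypothesis with the j-th prescribed count
        -- equal to m.
        have := ih (Function.update n j m)
        rw [prod_eq_mul_prod_erase_of_eq j
          (g := fun i => if i ∈ S then ∑' n, c i n * z i ^ n else c i (n i))
          (fun i hi => by simp [hi])] at this
        simp only [hj, if_false, Function.update_self] at this
        rw [← this]
        congr 1
        ext ω
        rw [prod_eq_mul_prod_erase_of_eq j (g := fun i => mixedFactor M z n (S : Set ι) i ω)]
        · simp [mixedFactor, hj]
        · intro i hi
          simp [mixedFactor, hi]
      simp_rw [e2]
      rw [prod_eq_mul_prod_erase_of_eq j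
        (g := fun i => if i ∈ S then ∑' n, c i n * z i ^ n else c i (n i))
        (fun i hi => by simp [hi])]
      simp only [Finset.mem_insert_self, if_true, ← ENNReal.tsum_mul_right]
      congr 1
      ext m
      ring
  have := key Finset.univ 0
  simpa [mixedFactor] using this

open Classical in
-- Converse of the previous result: with the other variables frozen, both sides are power series in
-- one `z j` with coefficients in [0, 1], and uniqueness of coefficients turns that power back into
-- an indicator. Iteration over the indices gives the joint law.
theorem measure_forall_eq_of_lintegral_prod_powENat (P : Measure Ω) [IsProbabilityMeasure P]
    (M : ι → Ω → ℕ∞)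
    (hM : ∀ i, Measurable (M i)) (c : ι → ℕ → ℝ≥0∞) (hc : ∀ i n, c i n ≤ 1)
    (hc1 : ∀ i (z : ℝ≥0∞), z < 1 → ∑' n, c i n * z ^ n ≤ 1)
    (h : ∀ z : ι → ℝ≥0∞, (∀ i, z i < 1) →
      ∫⁻ ω, ∏ i, powENat (z i) (M i ω) ∂P = ∏ i, ∑' n, c i n * z i ^ n) (n : ι → ℕ) :
    P {ω | ∀ i, M i ω = n i} = ∏ i, c i (n i) := by
  have hle : ∀ (z : ι → ℝ≥0∞) (_ : ∀ i, z i < 1) (n : ι → ℕ) (S : Set ι) (i : ι) (ω : Ω),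
      mixedFactor M z n S i ω ≤ 1 := by
    intro z hz n S i ω
    unfold mixedFactor
    split_ifs
    · induction M i ω using ENat.recTopCoe with
      | top => simp
      | coe k => simpa using pow_le_one₀ zero_le (hz i).le
    · exact le_rfl
    · exact zero_le
  have key : ∀ S : Finset ι, ∀ (z : ι → ℝ≥0∞) (_ : ∀ i, z i < 1) (n : ι → ℕ),
      ∫⁻ ω, ∏ i, mixedFactor M z n ((S : Set ι)ᶜ) i ω ∂P
        = ∏ i, if i ∈ S then c i (n i) else ∑' n, c i n * z i ^ n := by
    intro S
    induction S using Finset.induction_on with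
    | empty =>
      intro z hz n
      simpa [mixedFactor] using h z hz
    | insert j S hj ih =>
      intro z hz n
      set R : Ω → ℝ≥0∞ := fun ω =>
        ∏ i ∈ Finset.univ.erase j, mixedFactor M z n ((S : Set ι)ᶜ) i ω with hR
      set R' : ℝ≥0∞ := ∏ i ∈ Finset.univ.erase j,
        if i ∈ S then c i (n i) else ∑' n, c i n * z i ^ n with hR'
      have hRm : Measurable R :=
        Finset.measurable_prod _ fun i _ => measurable_mixedFactor M hM z n _ i
      have hR1 : ∀ ω, R ω ≤ 1 := fun ω => Finset.prod_le_one' fun i _ => hle z hz n _ i ω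
      have hR'1 : R' ≤ 1 := Finset.prod_le_one' fun i _ => by
        split_ifs
        · exact hc _ _
        · exact hc1 _ _ (hz i)
      have e1 : ∀ ω, ∏ i, mixedFactor M z n (((insert j S : Finset ι) : Set ι)ᶜ) i ω
          = (if M j ω = n j then 1 else 0) * R ω := by
        intro ω
        rw [prod_eq_mul_prod_erase_of_eq j (g := fun i => mixedFactor M z n ((S : Set ι)ᶜ) i ω)]
        · simp [mixedFactor, hR]
        · intro i hi
          simp [mixedFactor, hi]
      simp_rw [e1]
      rw [prod_eq_mul_prod_erase_of_eq j
        (g := fun i => if i ∈ S then c i (n i) else ∑' n, c i n * z i ^ n)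
        (fun i hi => by simp [hi])]
      simp only [Finset.mem_insert_self, if_true]
      refine coeff_eq_of_tsum_eq (n j)
        (fun m => ∫⁻ ω, (if M j ω = m then 1 else 0) * R ω ∂P) (fun m => c j m * R') ?_ ?_ ?_
      · intro m
        calc ∫⁻ ω, (if M j ω = m then 1 else 0) * R ω ∂P ≤ ∫⁻ _, 1 ∂P := by
              refine lintegral_mono fun ω => ?_
              refine mul_le_one' ?_ (hR1 ω)
              split_ifs <;> simp
          _ = 1 := by simp
      · intro m
        exact mul_le_one' (hc _ _) hR'1
      · intro y _ hy1
        rw [← lintegral_powENat_mul P _ (hM j) _ hRm]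
        have := ih (Function.update z j y) (fun i => by
          by_cases hi : i = j
          · subst hi; simpa using hy1
          · simpa [hi] using hz i) n
        rw [prod_eq_mul_prod_erase_of_eq j
          (g := fun i => if i ∈ S then c i (n i) else ∑' n, c i n * z i ^ n)
          (fun i hi => by simp [hi])] at this
        simp only [hj, if_false, Function.update_self] at this
        have e3 : ∀ m, c j m * R' * y ^ m = c j m * y ^ m * R' := fun m => by ring
        simp_rw [e3]
        rw [ENNReal.tsum_mul_right, ← this]
        congr 1
        ext ω
        rw [prod_eq_mul_prod_erase_of_eq j (g := fun i => mixedFactor M z n ((S : Set ι)ᶜ) i ω)]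
        · simp [mixedFactor, hj, hR]
        · intro i hi
          simp [mixedFactor, hi]
  -- Once every index has been converted, z no longer occurs, so any value below 1 will do.
  have := key Finset.univ (fun _ => 0) (by simp) n
  simp only [Finset.mem_univ, if_true] at this
  rw [← this, ← lintegral_indicator_one]
  · congr 1
    ext ω
    by_cases hω : ∀ i, M i ω = n i
    · simp [mixedFactor, hω]
    · have : ω ∉ {ω | ∀ i, M i ω = n i} := hω
      rw [Set.indicator_of_notMem this]
      push Not at hω
      obtain ⟨i, hi⟩ := hω
      exact (Finset.prod_eq_zero (Finset.mem_univ i) (by simp [mixedFactor, hi])).symm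
  · simp only [Set.ofPred_forall]
    exact MeasurableSet.iInter fun i => hM i (measurableSet_singleton _)

end PGF

/-! ### Poisson weights with mean in [0, ∞] -/

/-- `exp (-r)` for `r ∈ [0, ∞]`. -/
def expNeg (r : ℝ≥0∞) : ℝ≥0∞ := EReal.exp (-(r : EReal))

@[simp] lemma expNeg_top : expNeg ⊤ = 0 := by simp [expNeg]

lemma expNeg_coe (r : ℝ≥0) : expNeg r = ENNReal.ofReal (Real.exp (-r)) := by
  simp only [expNeg]
  rw [← EReal.exp_coe]
  rfl

lemma expNeg_eq_ofReal {r : ℝ≥0∞} (hr : r ≠ ⊤) :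
    expNeg r = ENNReal.ofReal (Real.exp (-r.toReal)) := by
  lift r to ℝ≥0 using hr
  exact expNeg_coe r

lemma expNeg_le_one (r : ℝ≥0∞) : expNeg r ≤ 1 := by
  simp [expNeg, EReal.exp_le_one_iff, EReal.coe_ennreal_nonneg]

lemma continuous_expNeg : Continuous expNeg :=
  ENNReal.continuous_exp.comp (continuous_neg.comp continuous_coe_ennreal_ereal)

@[simp] lemma expNeg_zero : expNeg 0 = 1 := by simp [expNeg]

lemma antitone_expNeg : Antitone expNeg := fun a b hab =>
  EReal.exp_monotone (EReal.neg_le_neg_iff.mpr (by exact_mod_cast hab))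

lemma expNeg_add (a b : ℝ≥0∞) : expNeg (a + b) = expNeg a * expNeg b := by
  induction a with
  | top => simp
  | coe a =>
    induction b with
    | top => simp
    | coe b =>
      rw [← ENNReal.coe_add, expNeg_coe, expNeg_coe, expNeg_coe, ← ENNReal.ofReal_mul (by positivity),
        ← Real.exp_add]
      push_cast
      ring_nf

lemma expNeg_sum {ι : Type*} (s : Finset ι) (f : ι → ℝ≥0∞) :
    expNeg (∑ i ∈ s, f i) = ∏ i ∈ s, expNeg (f i) := by
  classical
  induction s using Finset.induction_on with
  | empty => simp
  | insert a s ha ih => rw [Finset.sum_insert ha, Finset.prod_insert ha, expNeg_add, ih]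

lemma poissonProb_coe (r : ℝ≥0) (n : ℕ) :
    poissonProb r n = Real.exp (-r) * r ^ n / n.factorial := by
  simp [poissonProb, poissonMeasure_real_singleton]

@[simp] lemma poissonProb_top (n : ℕ) : poissonProb ⊤ n = 0 := by simp [poissonProb]

lemma poissonProb_nonneg (r : ℝ≥0∞) (n : ℕ) : 0 ≤ poissonProb r n := by
  unfold poissonProb; split_ifs <;> positivity

lemma poissonProb_le_one (r : ℝ≥0∞) (n : ℕ) : poissonProb r n ≤ 1 := by
  unfold poissonProb
  split_ifs
  · exact zero_le_one
  · exact measureReal_le_one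

/-- For infinite mean both sides vanish, which requires 1 - z > 0: at z = 1 the right side would be
`expNeg 0 = 1`. -/
lemma tsum_poissonProb_mul_pow (r : ℝ≥0∞) {z : ℝ≥0∞} (hz : z < 1) :
    ∑' n, ENNReal.ofReal (poissonProb r n) * z ^ n = expNeg ((1 - z) * r) := by
  induction r with
  | top =>
    rw [ENNReal.mul_top (tsub_pos_of_lt hz).ne']
    simp
  | coe r =>
    lift z to ℝ≥0 using ne_top_of_lt hz
    have hz1 : z ≤ 1 := by exact_mod_cast hz.le
    have h1 : ((1 : ℝ≥0∞) - z) * r = (((1 - z) * r : ℝ≥0) : ℝ≥0∞) := by push_cast; rfl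
    rw [h1, expNeg_coe]
    have h2 : ∀ n, ENNReal.ofReal (poissonProb r n) * (z : ℝ≥0∞) ^ n
        = ENNReal.ofReal (Real.exp (-r) * ((z * r) ^ n / n.factorial)) := by
      intro n
      rw [poissonProb_coe, ← ENNReal.coe_pow, ← ENNReal.ofReal_coe_nnreal,
        ← ENNReal.ofReal_mul (by positivity)]
      congr 1
      push_cast
      ring
    simp_rw [h2]
    have hs : HasSum (fun n : ℕ => ((z : ℝ) * r) ^ n / n.factorial) (Real.exp (z * r)) := by
      rw [Real.exp_eq_exp_ℝ]
      exact NormedSpace.expSeries_div_hasSum_exp (z * r : ℝ)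
    have hs2 := hs.mul_left (Real.exp (-r))
    rw [← ENNReal.ofReal_tsum_of_nonneg (fun n => by positivity) hs2.summable, hs2.tsum_eq,
      ← Real.exp_add]
    congr 2
    push_cast [NNReal.coe_sub hz1]
    ring

lemma tsum_poissonProb {r : ℝ≥0∞} (hr : r ≠ ⊤) :
    ∑' n, ENNReal.ofReal (poissonProb r n) = 1 := by
  lift r to ℝ≥0 using hr
  have h := hasSum_one_poissonMeasure r
  simp_rw [poissonProb_coe]
  rw [← ENNReal.ofReal_tsum_of_nonneg (fun n => by positivity) h.summable, h.tsum_eq]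
  simp

lemma tsum_poissonProb_mul_nat {r : ℝ≥0∞} (hr : r ≠ ⊤) :
    ∑' n : ℕ, (n : ℝ≥0∞) * ENNReal.ofReal (poissonProb r n) = r := by
  rw [tsum_eq_zero_add' ENNReal.summable]
  simp only [Nat.cast_zero, zero_mul, zero_add]
  have h : ∀ n : ℕ, ((n + 1 : ℕ) : ℝ≥0∞) * ENNReal.ofReal (poissonProb r (n + 1))
      = r * ENNReal.ofReal (poissonProb r n) := by
    intro n
    lift r to ℝ≥0 using hr
    rw [← ENNReal.ofReal_natCast, ← ENNReal.ofReal_coe_nnreal (p := r),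
      ← ENNReal.ofReal_mul (by positivity), ← ENNReal.ofReal_mul (by positivity)]
    rw [ENNReal.ofReal_coe_nnreal, poissonProb_coe, poissonProb_coe, Nat.factorial_succ]
    congr 1
    have : (n.factorial : ℝ) ≠ 0 := by positivity
    push_cast
    field_simp
    ring
  simp_rw [h]
  rw [ENNReal.tsum_mul_left, tsum_poissonProb hr, mul_one]

/-! ### Counts and infinite products along a sequence of points -/

/-- The number of indices of the sequence `y` at which it lies in `B`. -/
def hits {E : Type*} (y : ℕ → E) (B : Set E) : ℕ∞ := {n | y n ∈ B}.encard

/-- Counting indices is measurable for every outcome, whereas the definition of the process counts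
points; the two agree when the points are distinct. -/
lemma hits_eq_encard_range_inter {E : Type*} {y : ℕ → E} (hy : Function.Injective y) (B : Set E) :
    hits y B = (Set.range y ∩ B).encard := by
  rw [hits, ← hy.encard_image]
  congr 1
  ext e
  constructor
  · rintro ⟨n, hn, rfl⟩
    exact ⟨⟨n, rfl⟩, hn⟩
  · rintro ⟨⟨n, rfl⟩, hn⟩
    exact ⟨n, hn, rfl⟩

lemma measurable_encard_setOf {Ω : Type*} [MeasurableSpace Ω] {A : ℕ → Set Ω}
    (hA : ∀ n, MeasurableSet (A n)) : Measurable fun ω => {n | ω ∈ A n}.encard := by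
  refine Measurable.comp (g := Set.encard) measurable_encard ?_
  rw [measurable_set_iff]
  intro n
  exact measurable_mem.mpr (hA n)

lemma measurable_hits {Ω E : Type*} [MeasurableSpace Ω] [MeasurableSpace E] {Y : ℕ → Ω → E}
    (hY : ∀ n, Measurable (Y n)) {B : Set E} (hB : MeasurableSet B) :
    Measurable fun ω => hits (fun n => Y n ω) B :=
  measurable_encard_setOf (A := fun n => Y n ⁻¹' B) fun n => hY n hB

open Classical in
-- The exponent of z either stabilizes or tends to infinity. In the second case z < 1 forces the
-- limit 0, which is the convention `powENat z ⊤ = 0`.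
lemma tendsto_prod_ite_hits {E : Type*} (y : ℕ → E) (B : Set E) {z : ℝ≥0∞} (hz : z < 1) :
    Tendsto (fun N => ∏ n ∈ Finset.range N, if y n ∈ B then z else 1) atTop
      (𝓝 (powENat z (hits y B))) := by
  have e : ∀ N, (∏ n ∈ Finset.range N, if y n ∈ B then z else 1)
      = z ^ ((Finset.range N).filter (fun n => y n ∈ B)).card := by
    intro N
    rw [Finset.prod_ite]
    simp
  simp_rw [e]
  unfold hits
  by_cases hfin : {n | y n ∈ B}.Finite
  · rw [hfin.encard_eq_coe_toFinset_card, powENat_coe]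
    refine tendsto_const_nhds.congr' ?_
    filter_upwards [tendsto_finset_range.eventually_ge_atTop hfin.toFinset] with N hN
    congr 2
    ext n
    simp only [Set.Finite.mem_toFinset, Set.mem_ofPred_eq, Finset.mem_filter]
    exact ⟨fun h => ⟨hN (by simpa using h), h⟩, fun h => h.2⟩
  · rw [Set.encard_eq_top_iff.mpr hfin, powENat_top]
    refine (ENNReal.tendsto_pow_atTop_nhds_zero_of_lt_one hz).comp ?_
    refine tendsto_atTop.mpr fun K => ?_
    obtain ⟨t, ht, htK⟩ := Set.Infinite.exists_subset_card_eq hfin K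
    filter_upwards [tendsto_finset_range.eventually_ge_atTop t] with N hN
    rw [← htK]
    refine Finset.card_le_card fun n hn => ?_
    rw [Finset.mem_filter]
    exact ⟨hN hn, ht hn⟩

/-- The infinite product `∏ n, u (y n)` for `u ≤ 1`. -/
def infProd {E : Type*} (u : E → ℝ≥0∞) (y : ℕ → E) : ℝ≥0∞ :=
  ⨅ N, ∏ n ∈ Finset.range N, u (y n)

lemma antitone_prod_range {f : ℕ → ℝ≥0∞} (hf : ∀ n, f n ≤ 1) :
    Antitone fun N => ∏ n ∈ Finset.range N, f n := by
  refine antitone_nat_of_succ_le fun N => ?_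
  rw [Finset.prod_range_succ]
  exact mul_le_of_le_one_right' (hf N)

lemma tendsto_infProd {E : Type*} {u : E → ℝ≥0∞} (hu : ∀ e, u e ≤ 1) (y : ℕ → E) :
    Tendsto (fun N => ∏ n ∈ Finset.range N, u (y n)) atTop (𝓝 (infProd u y)) :=
  tendsto_atTop_iInf (antitone_prod_range fun n => hu (y n))

lemma powENat_le_one {z : ℝ≥0∞} (hz : z ≤ 1) (m : ℕ∞) : powENat z m ≤ 1 := by
  induction m using ENat.recTopCoe with
  | top => simp
  | coe k => simpa using pow_le_one₀ zero_le hz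

open Classical in
/-- The weight `∏ i, z i ^ 1_{B i}`. -/
def weight {E ι : Type*} [Fintype ι] (B : ι → Set E) (z : ι → ℝ≥0∞) (e : E) : ℝ≥0∞ :=
  ∏ i, if e ∈ B i then z i else 1

lemma weight_le_one {E ι : Type*} [Fintype ι] (B : ι → Set E) {z : ι → ℝ≥0∞} (hz : ∀ i, z i < 1)
    (e : E) : weight B z e ≤ 1 := by
  refine Finset.prod_le_one' fun i _ => ?_
  split_ifs
  · exact (hz i).le
  · exact le_rfl

lemma measurable_weight {E ι : Type*} [MeasurableSpace E] [Fintype ι] {B : ι → Set E}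
    (hB : ∀ i, MeasurableSet (B i)) (z : ι → ℝ≥0∞) : Measurable (weight B z) :=
  Finset.measurable_prod _ fun i _ => Measurable.ite (hB i) measurable_const measurable_const

lemma infProd_weight {E ι : Type*} [Fintype ι] (B : ι → Set E) {z : ι → ℝ≥0∞} (hz : ∀ i, z i < 1)
    (y : ℕ → E) : infProd (weight B z) y = ∏ i, powENat (z i) (hits y (B i)) := by
  refine tendsto_nhds_unique (tendsto_infProd (weight_le_one B hz) y) ?_
  unfold weight
  simp_rw [Finset.prod_comm (s := Finset.range _)]
  exact ENNReal.tendsto_finsetProd_of_ne_top _ (fun i _ => tendsto_prod_ite_hits y (B i) (hz i))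
    fun i _ => ne_top_of_le_ne_top ENNReal.one_ne_top (powENat_le_one (hz i).le _)

open Classical in
-- At most one factor of the weight differs from 1 because the sets are disjoint. This linearity
-- makes the exponent of the generating functional a sum over the sets.
lemma one_sub_weight {E ι : Type*} [Fintype ι] {B : ι → Set E}
    (hB : Pairwise (Function.onFun Disjoint B)) (z : ι → ℝ≥0∞) (e : E) :
    1 - weight B z e = ∑ i, (1 - z i) * (B i).indicator 1 e := by
  by_cases h : ∃ i, e ∈ B i
  · obtain ⟨i, hi⟩ := h
    have hne : ∀ j, j ≠ i → e ∉ B j := fun j hj hje =>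
      Set.disjoint_left.mp (hB hj) hje hi
    rw [weight, Finset.prod_eq_single i (fun j _ hj => by simp [hne j hj]) (by simp),
      Finset.sum_eq_single i (fun j _ hj => by simp [hne j hj]) (by simp)]
    simp [hi]
  · push Not at h
    simp [weight, h]

lemma lintegral_one_sub_weight {E ι : Type*} [MeasurableSpace E] [Fintype ι] {B : ι → Set E}
    (hBm : ∀ i, MeasurableSet (B i))
    (hB : Pairwise (Function.onFun Disjoint B)) (z : ι → ℝ≥0∞)
    (Λ : Measure E) :
    ∫⁻ e, (1 - weight B z e) ∂Λ = ∑ i, (1 - z i) * Λ (B i) := by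
  simp_rw [one_sub_weight hB z]
  rw [lintegral_finsetSum _ fun i _ => (measurable_one.indicator (hBm i)).const_mul _]
  refine Finset.sum_congr rfl fun i _ => ?_
  rw [lintegral_const_mul _ (measurable_one.indicator (hBm i)), lintegral_indicator_one (hBm i)]

/-! ### Generating functional and marking theorem -/

section

variable {Ω E : Type*} [MeasurableSpace Ω] [MeasurableSpace E]

lemma IsPoissonProcess.prob_count_fintype {P : Measure Ω} [IsFiniteMeasure P] {Λ : Measure E}
    {Φ : Ω → Set E} (h : IsPoissonProcess P Λ Φ) {ι : Type*} [Fintype ι] (B : ι → Set E)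
    (hB : ∀ i, MeasurableSet (B i)) (hd : Pairwise (Function.onFun Disjoint B)) (n : ι → ℕ) :
    P {ω | ∀ i, (Φ ω ∩ B i).encard = n i}
      = ∏ i, ENNReal.ofReal (poissonProb (Λ (B i)) (n i)) := by
  let e := (Fintype.equivFin ι).symm
  have := h.prob_count _ (fun j => B (e j)) (fun j => n (e j)) (fun j => hB _)
    (fun i j hij => hd (e.injective.ne hij))
  rw [← ENNReal.ofReal_prod_of_nonneg fun i _ => poissonProb_nonneg _ _]
  rw [← e.prod_comp, ← this, ofReal_measureReal]
  congr 1
  ext ω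
  exact (e.forall_congr_right (q := fun i => (Φ ω ∩ B i).encard = n i)).symm

lemma lintegral_infProd_weight {P : Measure Ω} [IsProbabilityMeasure P] {Λ : Measure E}
    {X : ℕ → Ω → E} (hX : ∀ n, Measurable (X n))
    (hinj : ∀ᵐ ω ∂P, Function.Injective fun n => X n ω)
    (h : IsPoissonProcess P Λ fun ω => Set.range fun n => X n ω) {ι : Type*} [Fintype ι]
    {B : ι → Set E} (hB : ∀ i, MeasurableSet (B i)) (hd : Pairwise (Function.onFun Disjoint B))
    {z : ι → ℝ≥0∞} (hz : ∀ i, z i < 1) :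
    ∫⁻ ω, infProd (weight B z) (fun n => X n ω) ∂P = expNeg (∫⁻ e, (1 - weight B z e) ∂Λ) := by
  simp_rw [infProd_weight B hz]
  rw [lintegral_prod_powENat P _ (fun i => measurable_hits hX (hB i))
    (fun i n => ENNReal.ofReal (poissonProb (Λ (B i)) n))]
  · rw [lintegral_one_sub_weight hB hd z, expNeg_sum]
    exact Finset.prod_congr rfl fun i _ => tsum_poissonProb_mul_pow _ (hz i)
  · intro n
    rw [← h.prob_count_fintype B hB hd n]
    refine measure_congr (Filter.eventuallyEq_set.mpr ?_)
    filter_upwards [hinj] with ω hω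
    simp only [hits_eq_encard_range_inter hω]

open Classical in
-- The level sets of a simple function are disjoint. The value 1 is left out, since it contributes
-- trivial factors and the generating function formula needs values below 1.
lemma simpleFunc_eq_weight (s : SimpleFunc E ℝ≥0∞) (e : E) :
    s e = weight (fun c : ↥(s.range.erase 1) => s ⁻¹' {(c : ℝ≥0∞)}) (fun c => (c : ℝ≥0∞)) e := by
  unfold weight
  by_cases h1 : s e = 1
  · rw [Finset.prod_eq_one, h1]
    intro c _
    have : s e ≠ c := by
      rw [h1]
      exact (Finset.ne_of_mem_erase c.2).symm
    simp [this]
  · rw [Finset.prod_eq_single ⟨s e, Finset.mem_erase.mpr ⟨h1, s.mem_range_self e⟩⟩]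
    · simp
    · intro c _ hc
      have : s e ≠ c := fun h => hc (Subtype.ext h.symm)
      simp [this]
    · simp

lemma lintegral_infProd_simpleFunc {P : Measure Ω} [IsProbabilityMeasure P] {Λ : Measure E}
    {X : ℕ → Ω → E} (hX : ∀ n, Measurable (X n))
    (hinj : ∀ᵐ ω ∂P, Function.Injective fun n => X n ω)
    (h : IsPoissonProcess P Λ fun ω => Set.range fun n => X n ω) (s : SimpleFunc E ℝ≥0∞)
    (hs : ∀ e, s e ≤ 1) :
    ∫⁻ ω, infProd s (fun n => X n ω) ∂P = expNeg (∫⁻ e, (1 - s e) ∂Λ) := by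
  classical
  rw [show (s : E → ℝ≥0∞) = _ from funext (simpleFunc_eq_weight s)]
  refine lintegral_infProd_weight hX hinj h (fun c => s.measurableSet_preimage _) ?_ ?_
  · intro c d hcd
    refine Set.disjoint_left.mpr fun e he he' => hcd (Subtype.ext ?_)
    simp only [Set.mem_preimage, Set.mem_singleton_iff] at he he'
    rw [← he, ← he']
  · intro c
    obtain ⟨hc1, hc⟩ := Finset.mem_erase.mp c.2
    obtain ⟨e, he⟩ := SimpleFunc.mem_range.mp hc
    exact lt_of_le_of_ne (he ▸ hs e) hc1

/-- The generating functional of a Poisson process. -/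
theorem lintegral_infProd {P : Measure Ω} [IsProbabilityMeasure P] {Λ : Measure E}
    {X : ℕ → Ω → E} (hX : ∀ n, Measurable (X n))
    (hinj : ∀ᵐ ω ∂P, Function.Injective fun n => X n ω)
    (h : IsPoissonProcess P Λ fun ω => Set.range fun n => X n ω) {u : E → ℝ≥0∞}
    (hu : Measurable u) (hu1 : ∀ e, u e ≤ 1) :
    ∫⁻ ω, infProd u (fun n => X n ω) ∂P = expNeg (∫⁻ e, (1 - u e) ∂Λ) := by
  set w : E → ℝ≥0∞ := fun e => 1 - u e with hw
  have hwm : Measurable w := measurable_const.sub hu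
  -- Approximating 1 - u from below gives simple functions decreasing to u. The products then
  -- decrease as well, so monotone convergence applies both to the products and to the exponent.
  set s : ℕ → SimpleFunc E ℝ≥0∞ := fun k => (SimpleFunc.eapprox w k).map (fun c => 1 - c) with hs
  have hsk : ∀ k e, s k e = 1 - SimpleFunc.eapprox w k e := fun k e => rfl
  have hs1 : ∀ k e, s k e ≤ 1 := fun k e => by rw [hsk]; exact tsub_le_self
  have hle : ∀ k e, SimpleFunc.eapprox w k e ≤ 1 := fun k e => by
    calc SimpleFunc.eapprox w k e ≤ ⨆ n, SimpleFunc.eapprox w n e :=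
          le_iSup (fun n => SimpleFunc.eapprox w n e) k
      _ = w e := SimpleFunc.iSup_eapprox_apply hwm e
      _ ≤ 1 := tsub_le_self
  have hanti : ∀ e, Antitone fun k => s k e := fun e k l hkl => by
    simp only [hsk]
    exact tsub_le_tsub_left (SimpleFunc.monotone_eapprox w hkl e) _
  have hlim : ∀ e, Tendsto (fun k => s k e) atTop (𝓝 (u e)) := by
    intro e
    have h1 : Tendsto (fun k => SimpleFunc.eapprox w k e) atTop (𝓝 (w e)) := by
      rw [← SimpleFunc.iSup_eapprox_apply hwm e]
      exact tendsto_atTop_iSup fun k l hkl => SimpleFunc.monotone_eapprox w hkl e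
    have h2 := ENNReal.Tendsto.sub (tendsto_const_nhds (x := (1 : ℝ≥0∞))) h1
      (Or.inl ENNReal.one_ne_top)
    simp only [hw] at h2
    rwa [ENNReal.sub_sub_cancel ENNReal.one_ne_top (hu1 e)] at h2
  have hprod : ∀ y : ℕ → E, ⨅ k, infProd (s k) y = infProd u y := by
    intro y
    unfold infProd
    rw [iInf_comm]
    congr 1
    ext N
    refine tendsto_nhds_unique (tendsto_atTop_iInf ?_) ?_
    · exact fun k l hkl => Finset.prod_le_prod' fun n _ => hanti (y n) hkl
    · exact ENNReal.tendsto_finsetProd_of_ne_top _ (fun n _ => hlim (y n))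
        fun n _ => ne_top_of_le_ne_top ENNReal.one_ne_top (hu1 _)
  have hmeas : ∀ k, Measurable fun ω => infProd (s k) fun n => X n ω := fun k =>
    Measurable.iInf fun N => Finset.measurable_prod _ fun n _ => (s k).measurable.comp (hX n)
  simp_rw [← hprod]
  rw [lintegral_iInf hmeas]
  · simp_rw [lintegral_infProd_simpleFunc hX hinj h _ (hs1 _)]
    have hint : ∀ k, ∫⁻ e, (1 - s k e) ∂Λ = ∫⁻ e, SimpleFunc.eapprox w k e ∂Λ := by
      intro k
      simp only [hsk]
      congr 1
      ext e
      exact ENNReal.sub_sub_cancel ENNReal.one_ne_top (hle k e)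
    simp_rw [hint]
    have hmono : Monotone fun k => ∫⁻ e, SimpleFunc.eapprox w k e ∂Λ := fun k l hkl =>
      lintegral_mono (SimpleFunc.monotone_eapprox w hkl)
    have hsup : ∫⁻ e, w e ∂Λ = ⨆ k, ∫⁻ e, SimpleFunc.eapprox w k e ∂Λ := by
      rw [← lintegral_iSup (fun k => (SimpleFunc.eapprox w k).measurable)
        (fun k l hkl => SimpleFunc.monotone_eapprox w hkl)]
      simp_rw [SimpleFunc.iSup_eapprox_apply hwm]
    rw [hsup]
    refine tendsto_nhds_unique (tendsto_atTop_iInf fun k l hkl => antitone_expNeg (hmono hkl)) ?_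
    exact (continuous_expNeg.tendsto _).comp (tendsto_atTop_iSup hmono)
  · intro k l hkl ω
    exact le_iInf fun N => (iInf_le _ N).trans
      (Finset.prod_le_prod' fun n _ => hanti (X n ω) hkl)
  · refine ne_top_of_le_ne_top ENNReal.one_ne_top ?_
    calc ∫⁻ ω, infProd (s 0) (fun n => X n ω) ∂P ≤ ∫⁻ _, 1 ∂P :=
          lintegral_mono fun ω => (iInf_le _ 0).trans (by simp)
      _ = 1 := by simp

/-- Averaging a product functional over independent i.i.d. marks. -/
theorem lintegral_infProd_marked {M : Type*} [MeasurableSpace M] {P : Measure Ω}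
    [IsProbabilityMeasure P] {law : Measure M} [IsProbabilityMeasure law] {X : ℕ → Ω → E}
    {H : ℕ → Ω → M} (hX : ∀ n, Measurable (X n)) (hH : ∀ n, Measurable (H n))
    (hlaw : ∀ n, P.map (H n) = law) (hiid : iIndepFun H P)
    (hind : IndepFun (fun ω n => X n ω) (fun ω n => H n ω) P) {v : E × M → ℝ≥0∞}
    (hv : Measurable v) (hv1 : ∀ e, v e ≤ 1) :
    ∫⁻ ω, infProd v (fun n => (X n ω, H n ω)) ∂P
      = ∫⁻ ω, infProd (fun x => ∫⁻ h, v (x, h) ∂law) (fun n => X n ω) ∂P := by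
  have hXm : Measurable fun ω n => X n ω := measurable_pi_lambda _ hX
  have hHm : Measurable fun ω n => H n ω := measurable_pi_lambda _ hH
  have hm' : Measurable fun x => ∫⁻ h, v (x, h) ∂law := hv.lintegral_prod_right'
  have h1' : ∀ x, ∫⁻ h, v (x, h) ∂law ≤ 1 := fun x =>
    (lintegral_mono fun h => hv1 (x, h)).trans (by simp)
  unfold infProd
  -- The partial products decrease and are bounded by 1, so the infimum leaves the integral and only
  -- finite products remain.
  rw [lintegral_iInf, lintegral_iInf]
  rotate_left
  · exact fun N => Finset.measurable_prod _ fun n _ => hm'.comp (hX n)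
  · exact fun N K hNK ω => antitone_prod_range (fun n => h1' (X n ω)) hNK
  · simp
  · exact fun N => Finset.measurable_prod _ fun n _ => hv.comp ((hX n).prodMk (hH n))
  · exact fun N K hNK ω => antitone_prod_range (fun n => hv1 (X n ω, H n ω)) hNK
  · simp
  congr 1
  ext N
  have hprobX : IsProbabilityMeasure (P.map fun ω n => X n ω) :=
    Measure.isProbabilityMeasure_map hXm.aemeasurable
  have hprobH : IsProbabilityMeasure (P.map fun ω n => H n ω) :=
    Measure.isProbabilityMeasure_map hHm.aemeasurable
  have hG : Measurable fun p : (ℕ → E) × (ℕ → M) => ∏ n ∈ Finset.range N, v (p.1 n, p.2 n) :=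
    Finset.measurable_prod _ fun n _ => hv.comp
      (((measurable_pi_apply n).comp measurable_fst).prodMk
        ((measurable_pi_apply n).comp measurable_snd))
  -- With the positions frozen, the factors are functions of independent marks, so the integral of
  -- their product factorizes.
  have hinner : ∀ x : ℕ → E, ∫⁻ h, ∏ n ∈ Finset.range N, v (x n, h n) ∂(P.map fun ω n => H n ω)
      = ∏ n ∈ Finset.range N, ∫⁻ h, v (x n, h) ∂law := by
    intro x
    rw [lintegral_map (f := fun h : ℕ → M => ∏ n ∈ Finset.range N, v (x n, h n))
      (hG.comp measurable_prodMk_left) hHm]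
    rw [lintegral_prod_eq_prod_lintegral_of_indepFun (Finset.range N)
      (fun n ω => v (x n, H n ω))
      (hiid.comp (fun n h => v (x n, h)) fun n => hv.comp measurable_prodMk_left)
      (fun n => (hv.comp measurable_prodMk_left).comp (hH n))]
    refine Finset.prod_congr rfl fun n _ => ?_
    rw [← hlaw n, lintegral_map (f := fun h => v (x n, h)) (hv.comp measurable_prodMk_left) (hH n)]
  have hjoint := (indepFun_iff_map_prod_eq_prod_map_map hXm.aemeasurable hHm.aemeasurable).mp hind
  calc ∫⁻ ω, ∏ n ∈ Finset.range N, v (X n ω, H n ω) ∂P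
      = ∫⁻ p, ∏ n ∈ Finset.range N, v (p.1 n, p.2 n)
          ∂(P.map fun ω => ((fun n => X n ω), fun n => H n ω)) := by
        rw [lintegral_map hG (hXm.prodMk hHm)]
    _ = ∫⁻ x, ∫⁻ h, ∏ n ∈ Finset.range N, v (x n, h n) ∂(P.map fun ω n => H n ω)
          ∂(P.map fun ω n => X n ω) := by
        rw [hjoint, lintegral_prod _ hG.aemeasurable]
    _ = ∫⁻ x, ∏ n ∈ Finset.range N, ∫⁻ h, v (x n, h) ∂law ∂(P.map fun ω n => X n ω) := by
        simp_rw [hinner]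
    _ = _ := by
        rw [lintegral_map (f := fun x : ℕ → E => ∏ n ∈ Finset.range N, ∫⁻ h, v (x n, h) ∂law)
          (Finset.measurable_prod _ fun n _ => hm'.comp (measurable_pi_apply n)) hXm]

/-- The marking theorem: joint law of the numbers of marked points in disjoint sets. -/
theorem measure_forall_hits_eq {M : Type*} [MeasurableSpace M] {P : Measure Ω}
    [IsProbabilityMeasure P] {law : Measure M} [IsProbabilityMeasure law] {Λ : Measure E}
    [SFinite Λ] {X : ℕ → Ω → E}
    {H : ℕ → Ω → M} (hX : ∀ n, Measurable (X n)) (hH : ∀ n, Measurable (H n))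
    (hinj : ∀ᵐ ω ∂P, Function.Injective fun n => X n ω)
    (h : IsPoissonProcess P Λ fun ω => Set.range fun n => X n ω)
    (hlaw : ∀ n, P.map (H n) = law) (hiid : iIndepFun H P)
    (hind : IndepFun (fun ω n => X n ω) (fun ω n => H n ω) P) {ι : Type*} [Fintype ι]
    {B : ι → Set (E × M)} (hB : ∀ i, MeasurableSet (B i))
    (hd : Pairwise (Function.onFun Disjoint B)) (n : ι → ℕ) :
    P {ω | ∀ i, hits (fun n => (X n ω, H n ω)) (B i) = n i}
      = ∏ i, ENNReal.ofReal (poissonProb (Λ.prod law (B i)) (n i)) := by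
  refine measure_forall_eq_of_lintegral_prod_powENat P
    (fun i ω => hits (fun n => (X n ω, H n ω)) (B i))
    (fun i => measurable_hits (fun n => (hX n).prodMk (hH n)) (hB i))
    (fun i n => ENNReal.ofReal (poissonProb (Λ.prod law (B i)) n)) ?_ ?_ ?_ n
  · exact fun i n => ENNReal.ofReal_le_one.mpr (poissonProb_le_one _ _)
  · intro i z hz
    rw [tsum_poissonProb_mul_pow _ hz]
    exact expNeg_le_one _
  · intro z hz
    have hvm := measurable_weight hB z
    have hv1 := weight_le_one B hz
    simp_rw [← infProd_weight B hz]
    rw [lintegral_infProd_marked hX hH hlaw hiid hind hvm hv1,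
      lintegral_infProd hX hinj h hvm.lintegral_prod_right'
        (fun x => (lintegral_mono fun h => hv1 (x, h)).trans (by simp))]
    -- Since `law` has mass 1, the complement of the averaged weight is the average of the
    -- complement; Fubini then produces the product intensity.
    have hsub : ∀ x, 1 - ∫⁻ h, weight B z (x, h) ∂law
        = ∫⁻ h, (1 - weight B z (x, h)) ∂law := by
      intro x
      rw [lintegral_sub (g := fun h => weight B z (x, h)) (hvm.comp measurable_prodMk_left)
        (ne_top_of_le_ne_top ENNReal.one_ne_top
          ((lintegral_mono fun h => hv1 (x, h)).trans (by simp)))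
        (Eventually.of_forall fun h => hv1 (x, h))]
      simp
    simp_rw [hsub]
    rw [← lintegral_prod (fun p => 1 - weight B z p) (measurable_const.sub hvm).aemeasurable,
      lintegral_one_sub_weight hB hd z, expNeg_sum]
    exact Finset.prod_congr rfl fun i _ => (tsum_poissonProb_mul_pow _ (hz i)).symm

end

/-! ### Deterministic geometry of the zone -/

/-- The points to the left of `b` from which the slope to `b` is at least `t`. -/
def shadeLeft (b : Pt) (t : ℝ) : Set Pt := {p | p.1 < b.1 ∧ t ≤ incline p b}

/-- The points to the left of `b` from which the slope to `b` is smaller than `t`. -/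
def aboveLeft (b : Pt) (t : ℝ) : Set Pt := {p | p.1 < b.1 ∧ incline p b < t}

lemma incline_le_iff {p r : Pt} (h : p.1 < r.1) (t : ℝ) :
    incline p r ≤ t ↔ (r.2 : ℝ) - p.2 ≤ t * (r.1 - p.1) :=
  div_le_iff₀ (sub_pos.mpr h)

lemma le_incline_iff {p r : Pt} (h : p.1 < r.1) (t : ℝ) :
    t ≤ incline p r ↔ t * (r.1 - p.1) ≤ (r.2 : ℝ) - p.2 :=
  le_div_iff₀ (sub_pos.mpr h)

lemma incline_mul {p r : Pt} (h : p.1 < r.1) :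
    incline p r * (r.1 - p.1) = (r.2 : ℝ) - p.2 :=
  div_mul_cancel₀ _ (sub_pos.mpr h).ne'

lemma not_mem_aboveLeft_iff {b : Pt} {t : ℝ} {r : Pt} (h : r.1 < b.1) :
    r ∉ aboveLeft b t ↔ r ∈ shadeLeft b t := by
  simp [aboveLeft, shadeLeft, h]

lemma disjoint_shadeLeft_aboveLeft (b : Pt) (t : ℝ) :
    Disjoint (shadeLeft b t) (aboveLeft b t) :=
  Set.disjoint_left.mpr fun _ h h' => not_lt.mpr h.2 h'.2

/-- Induction along the chain of relays from p to b. Each step uses that the slope of a segment is a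
weighted mean of the slopes of its two pieces, so maximality at the relay forces later slopes to be
no larger than earlier ones. -/
theorem zone_subset {L : Set Pt} {b q : Pt} (hb : b ∈ L) (hq : q ∈ L) (hbq : b.1 < q.1) {p : Pt}
    (hp : p ∈ zone L b) :
    p = b ∨ (p ∈ shadeLeft b (incline b q) ∧
      ∀ r ∈ L, p.1 < r.1 → r.1 < b.1 → r ∈ shadeLeft b (incline b q)) := by
  induction hp using Relation.ReflTransGen.head_induction_on with
  | refl => exact Or.inl rfl
  | @head p c h _ ih =>
    right
    set t := incline b q with ht
    obtain ⟨⟨hcL, hpc, hmax⟩, -⟩ := h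
    have hbq' := incline_mul hbq
    rcases ih with rfl | ⟨⟨hcb, htc⟩, hbetween⟩
    -- The relay is b itself. As q is not above the line from p through b, that line has slope at
    -- least t; a building between p and b is not above it either, and so sees b under a slope at
    -- least t.
    · have h1 := hmax q hq (hpc.trans hbq)
      rw [incline_le_iff (hpc.trans hbq)] at h1
      have h2 := incline_mul hpc
      have htp : t ≤ incline p c := by
        by_contra! hlt
        nlinarith [mul_lt_mul_of_pos_right hlt (sub_pos.mpr hbq)]
      refine ⟨⟨hpc, htp⟩, fun r hr hpr hrc => ⟨hrc, ?_⟩⟩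
      have h3 := hmax r hr hpr
      rw [incline_le_iff hpr] at h3
      rw [le_incline_iff hrc]
      nlinarith [mul_le_mul_of_nonneg_right htp (sub_pos.mpr hrc).le]
    · have hpb : p.1 < b.1 := hpc.trans hcb
      have h1 := hmax b hb hpb
      rw [incline_le_iff hpb] at h1
      have h2 := incline_mul hpc
      have h3 := incline_mul hcb
      -- As c maximizes the slope from p, the point b is not above the line from p through c, so the
      -- slope does not increase at c.
      have hcm : incline c b ≤ incline p c := by
        by_contra! hlt
        nlinarith [mul_lt_mul_of_pos_right hlt (sub_pos.mpr hcb)]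
      have htm : t ≤ incline p c := htc.trans hcm
      have hA := mul_le_mul_of_nonneg_right htc (sub_pos.mpr hcb).le
      refine ⟨⟨hpb, ?_⟩, fun r hr hpr hrb => ?_⟩
      · rw [le_incline_iff hpb]
        nlinarith [mul_le_mul_of_nonneg_right htm (sub_pos.mpr hpc).le]
      · rcases lt_or_ge c.1 r.1 with hcr | hrc
        · exact hbetween r hr hcr hrb
        · refine ⟨hrb, ?_⟩
          have h4 := hmax r hr hpr
          rw [incline_le_iff hpr] at h4
          rw [le_incline_iff hrb]
          nlinarith [mul_le_mul_of_nonneg_right htm (sub_nonneg.mpr hrc)]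

/-- Strong induction on the number of buildings with base in (p.1, b.1]. Buildings beyond b cannot
beat b as seen from p, so the maximal slope is attained among these finitely many buildings. The
leftmost maximizer is the relay: it is b, or again a point of the shade with fewer buildings ahead.
-/
theorem mem_zone_of_forall_mem_shadeLeft {L : Set Pt} {b : Pt} {t : ℝ} (hb : b ∈ L)
    (hinj : ∀ r ∈ L, r.1 = b.1 → r = b) (hmax : ∀ r ∈ L, b.1 < r.1 → incline b r ≤ t)
    (hfin : ∀ x, {r | r ∈ L ∧ x < r.1 ∧ r.1 ≤ b.1}.Finite) (n : ℕ) :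
    ∀ p ∈ shadeLeft b t, (∀ r ∈ L, p.1 < r.1 → r.1 < b.1 → r ∈ shadeLeft b t) →
      {r | r ∈ L ∧ p.1 < r.1 ∧ r.1 ≤ b.1}.ncard = n → p ∈ zone L b := by
  induction n using Nat.strong_induction_on with
  | _ n ih =>
    rintro p ⟨hpb, htp⟩ hbetween hn
    set F : Set Pt := {r | r ∈ L ∧ p.1 < r.1 ∧ r.1 ≤ b.1} with hF
    have hbF : b ∈ F := ⟨hb, hpb, le_rfl⟩
    obtain ⟨m, hmF, hm⟩ := Set.exists_max_image F (incline p) (hfin p.1) ⟨b, hbF⟩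
    obtain ⟨c, ⟨hcF, hcm⟩, hc⟩ := Set.exists_min_image {r | r ∈ F ∧ incline p r = incline p m}
      (fun r => r.1) ((hfin p.1).subset fun r hr => hr.1) ⟨m, hmF, rfl⟩
    have hblock : IsBlockingBuilding L p c := by
      have hcmax : ∀ r ∈ L, p.1 < r.1 → incline p r ≤ incline p c := by
        intro r hr hpr
        rw [hcm]
        rcases le_or_gt r.1 b.1 with hrb | hbr
        · exact hm r ⟨hr, hpr, hrb⟩
        -- To the right of b all buildings stay below the line of slope t through b, and the line
        -- from p through b is at least as steep.
        · refine le_trans ?_ (hm b hbF)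
          have h1 := (hmax r hr hbr).trans htp
          rw [incline_le_iff hbr] at h1
          rw [incline_le_iff hpr]
          have h2 := incline_mul hpb
          nlinarith
      refine ⟨⟨hcF.1, hcF.2.1, hcmax⟩, ?_⟩
      rintro r ⟨hr, hpr, hrmax⟩
      rcases le_or_gt r.1 b.1 with hrb | hbr
      · exact hc r ⟨⟨hr, hpr, hrb⟩, le_antisymm (hm r ⟨hr, hpr, hrb⟩) (hrmax m hmF.1 hmF.2.1)⟩
      · exact hcF.2.2.trans hbr.le
    rcases hcF.2.2.lt_or_eq with hcb | hcb
    · have hsub : {r | r ∈ L ∧ c.1 < r.1 ∧ r.1 ≤ b.1} ⊂ F := by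
        refine ⟨fun r hr => ⟨hr.1, hcF.2.1.trans hr.2.1, hr.2.2⟩, fun h => ?_⟩
        exact lt_irrefl _ (h hcF).2.1
      refine Relation.ReflTransGen.head hblock (ih _ (hn ▸ Set.ncard_lt_ncard hsub (hfin p.1)) c
        (hbetween c hcF.1 hcF.2.1 hcb)
        (fun r hr hcr hrb => hbetween r hr (hcF.2.1.trans hcr) hrb) rfl)
    · have : c = b := hinj c hcF.1 hcb
      exact Relation.ReflTransGen.single (this ▸ hblock)

/-- The supremum of the bases of the buildings of `L` in `aboveLeft b t`. -/
def cutLevel (L : Set Pt) (b : Pt) (t : ℝ) : EReal :=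
  sSup ((fun r : Pt => (r.1 : EReal)) '' (L ∩ aboveLeft b t))

lemma cutLevel_le_iff {L : Set Pt} {b : Pt} {t : ℝ} {x : EReal} :
    cutLevel L b t ≤ x ↔ ∀ r ∈ L, r ∈ aboveLeft b t → (r.1 : EReal) ≤ x := by
  simp only [cutLevel, sSup_le_iff, Set.mem_image, Set.mem_inter_iff, forall_exists_index, and_imp]
  constructor
  · exact fun h r hr hr' => h _ r hr hr' rfl
  · rintro h _ r hr hr' rfl
    exact h r hr hr'

section Splice

variable {L' L : Set Pt} {α : ℝ} {β : ℝ≥0} {q : Pt}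

lemma mem_splice_of_lt {r : Pt} (h : r.1 < α) : r ∈ splice L' L α ↔ r ∈ L := by
  simp [splice, h, not_le.mpr h]

lemma mem_splice_of_ge {r : Pt} (h : α ≤ r.1) : r ∈ splice L' L α ↔ r ∈ L' := by
  simp [splice, h, not_lt.mpr h]

/-- The only building with base α is b, which lies in its own reverse shade. Hence the candidates
for cutting are exactly the points of L strictly to the left, above the line. -/
lemma shadowCuttingBase_splice (hL' : IsLandscape L') (hb : (α, β) ∈ L') :
    shadowCuttingBase (splice L' L α) (α, β) q = cutLevel L (α, β) (incline (α, β) q) := by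
  unfold shadowCuttingBase cutLevel
  congr 2
  ext r
  simp only [reverseShade, Set.mem_ofPred_eq, Set.mem_inter_iff, aboveLeft, not_or, not_and, not_le]
  constructor
  · rintro ⟨hr, hle, h1, h2⟩
    rcases hle.lt_or_eq with hlt | heq
    · exact ⟨(mem_splice_of_lt hlt).mp hr, hlt, h1 hlt⟩
    · have : r = (α, β) := hL'.injOn_base ((mem_splice_of_ge heq.ge).mp hr) hb heq
      exact absurd (h2 heq) (by simp [this])
  · rintro ⟨hr, hlt, h⟩
    exact ⟨(mem_splice_of_lt hlt).mpr hr, hlt.le, fun _ => h, fun h' => absurd h' hlt.ne⟩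

/-- The absence of cutting buildings strictly between p and b is a bound on the cut level. Equality
is allowed because a building over or under p plays no role in relaying p. -/
theorem mem_zone_splice_iff (hL' : IsLandscape L') (hb : (α, β) ∈ L')
    (hq : IsBlockingBuilding L' (α, β) q) (hfin : ∀ x, {r | r ∈ L ∧ x < r.1 ∧ r.1 < α}.Finite)
    (p : Pt) :
    p ∈ zone (splice L' L α) (α, β) ↔ p = (α, β) ∨
      (p ∈ shadeLeft (α, β) (incline (α, β) q) ∧
        cutLevel L (α, β) (incline (α, β) q) ≤ (p.1 : EReal)) := by
  obtain ⟨⟨hqL, hbq, hqmax⟩, -⟩ := hq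
  have hb' : (α, β) ∈ splice L' L α := (mem_splice_of_ge le_rfl).mpr hb
  have hq' : q ∈ splice L' L α := (mem_splice_of_ge hbq.le).mpr hqL
  have hinj : ∀ r ∈ splice L' L α, r.1 = α → r = (α, β) := fun r hr h =>
    hL'.injOn_base ((mem_splice_of_ge h.ge).mp hr) hb h
  have hcut : cutLevel L (α, β) (incline (α, β) q) ≤ (p.1 : EReal) ↔
      ∀ r ∈ splice L' L α, p.1 < r.1 → r.1 < α → r ∈ shadeLeft (α, β) (incline (α, β) q) := by
    rw [cutLevel_le_iff]
    constructor
    · intro h r hr hpr hrα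
      by_contra hns
      rw [← not_mem_aboveLeft_iff (b := (α, β)) hrα, not_not] at hns
      have := h r ((mem_splice_of_lt hrα).mp hr) hns
      exact absurd (EReal.coe_le_coe_iff.mp this) (not_le.mpr hpr)
    · intro h r hr hra
      rw [EReal.coe_le_coe_iff]
      by_contra! hpr
      have := h r ((mem_splice_of_lt hra.1).mpr hr) hpr hra.1
      exact Set.disjoint_left.mp (disjoint_shadeLeft_aboveLeft _ _) this hra
  rw [hcut]
  constructor
  · exact zone_subset hb' hq' hbq
  · rintro (rfl | ⟨hp, h⟩)
    · exact Relation.ReflTransGen.refl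
    · refine mem_zone_of_forall_mem_shadeLeft hb' hinj ?_ ?_ _ p hp h rfl
      · exact fun r hr hbr => hqmax r ((mem_splice_of_ge (le_of_lt hbr)).mp hr) hbr
      · intro x
        refine ((hfin x).insert (α, β)).subset ?_
        rintro r ⟨hr, hx, hrα⟩
        rcases hrα.lt_or_eq with hlt | heq
        · exact Or.inr ⟨(mem_splice_of_lt hlt).mp hr, hx, hlt⟩
        · exact Or.inl (hinj r hr heq)

/-- The part of `shadeLeft b t` with abscissa at least `x`. -/
def shadeFrom (b : Pt) (t : ℝ) (x : EReal) : Set Pt :=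
  {p | p ∈ shadeLeft b t ∧ x ≤ (p.1 : EReal)}

lemma zone_splice_eq (hL' : IsLandscape L') (hb : (α, β) ∈ L')
    (hq : IsBlockingBuilding L' (α, β) q) (hfin : ∀ x, {r | r ∈ L ∧ x < r.1 ∧ r.1 < α}.Finite) :
    zone (splice L' L α) (α, β) = insert (α, β)
      (shadeFrom (α, β) (incline (α, β) q) (cutLevel L (α, β) (incline (α, β) q))) := by
  ext p
  exact mem_zone_splice_iff hL' hb hq hfin p

lemma relayedBuildings_splice_eq (hL' : IsLandscape L') (hb : (α, β) ∈ L')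
    (hq : IsBlockingBuilding L' (α, β) q) (hfin : ∀ x, {r | r ∈ L ∧ x < r.1 ∧ r.1 < α}.Finite) :
    relayedBuildings (splice L' L α) (α, β) = L ∩
      shadeFrom (α, β) (incline (α, β) q) (cutLevel L (α, β) (incline (α, β) q)) := by
  rw [relayedBuildings, zone_splice_eq hL' hb hq hfin]
  ext r
  constructor
  · rintro ⟨⟨hr, h | h⟩, hne⟩
    · exact absurd h hne
    · exact ⟨(mem_splice_of_lt h.1.1).mp hr, h⟩
  · rintro ⟨hr, h⟩
    refine ⟨⟨(mem_splice_of_lt h.1.1).mpr hr, Or.inr h⟩, ?_⟩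
    rintro rfl
    exact lt_irrefl _ h.1.1

end Splice

/-! ### Measurability of the zone -/

/-- The points whose `n`-th relay is `b`. -/
def relayStep (L : Set Pt) (b : Pt) : ℕ → Pt → Prop
  | 0, p => p = b
  | n + 1, p => ∃ c ∈ L, IsBlockingBuilding L p c ∧ relayStep L b n c

/-- Written this way, membership quantifies only over an integer and over points of a countable
landscape, so measurability follows by induction on the number of relays. -/
lemma mem_zone_iff_exists_relayStep {L : Set Pt} {b p : Pt} :
    p ∈ zone L b ↔ ∃ n, relayStep L b n p := by
  constructor
  · intro h
    induction h using Relation.ReflTransGen.head_induction_on with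
    | refl => exact ⟨0, rfl⟩
    | @head p c h _ ih =>
      obtain ⟨n, hn⟩ := ih
      exact ⟨n + 1, c, h.1.1, h, hn⟩
  · rintro ⟨n, hn⟩
    induction n generalizing p with
    | zero =>
      obtain rfl : p = b := hn
      exact Relation.ReflTransGen.refl
    | succ n ih =>
      obtain ⟨c, -, h, hc⟩ := hn
      exact Relation.ReflTransGen.head h (ih hc)

lemma measurable_incline {Ω : Type*} [MeasurableSpace Ω] {p r : Ω → Pt} (hp : Measurable p)
    (hr : Measurable r) : Measurable fun ω => incline (p ω) (r ω) := by
  unfold incline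
  exact ((hr.snd.coe_nnreal_real).sub (hp.snd.coe_nnreal_real)).div (hr.fst.sub hp.fst)

section

variable {Ω ι : Type*} [MeasurableSpace Ω] [Countable ι] {y : ι → Ω → Pt}
  {A : ι → Set Ω} {L : Ω → Set Pt}

/-- The random landscape is presented as a countable family of measurable points, the i-th being
present on the event `A i`; a quantifier over the landscape becomes a countable operation on events.
-/
lemma measurableSet_forall_mem (hA : ∀ i, MeasurableSet (A i))
    (hL : ∀ ω, L ω = {r | ∃ i, ω ∈ A i ∧ y i ω = r}) {Q : Ω → Pt → Prop}
    (hQ : ∀ i, MeasurableSet {ω | Q ω (y i ω)}) : MeasurableSet {ω | ∀ r ∈ L ω, Q ω r} := by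
  have : {ω | ∀ r ∈ L ω, Q ω r} = ⋂ i, ((A i)ᶜ ∪ {ω | Q ω (y i ω)}) := by
    ext ω
    simp only [hL, Set.mem_ofPred_eq, Set.mem_iInter, Set.mem_union, Set.mem_compl_iff]
    constructor
    · exact fun h i => or_iff_not_imp_left.mpr fun hi => h _ ⟨i, not_not.mp hi, rfl⟩
    · rintro h _ ⟨i, hi, rfl⟩
      exact (h i).resolve_left (not_not.mpr hi)
  rw [this]
  exact MeasurableSet.iInter fun i => (hA i).compl.union (hQ i)

lemma measurableSet_exists_mem (hA : ∀ i, MeasurableSet (A i))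
    (hL : ∀ ω, L ω = {r | ∃ i, ω ∈ A i ∧ y i ω = r}) {Q : Ω → Pt → Prop}
    (hQ : ∀ i, MeasurableSet {ω | Q ω (y i ω)}) : MeasurableSet {ω | ∃ r ∈ L ω, Q ω r} := by
  have : {ω | ∃ r ∈ L ω, Q ω r} = ⋃ i, (A i ∩ {ω | Q ω (y i ω)}) := by
    ext ω
    simp only [hL, Set.mem_ofPred_eq, Set.mem_iUnion, Set.mem_inter_iff]
    constructor
    · rintro ⟨_, ⟨i, hi, rfl⟩, h⟩
      exact ⟨i, hi, h⟩
    · rintro ⟨i, hi, h⟩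
      exact ⟨_, ⟨i, hi, rfl⟩, h⟩
  rw [this]
  exact MeasurableSet.iUnion fun i => (hA i).inter (hQ i)

lemma measurableSet_mem_maximizers (hy : ∀ i, Measurable (y i)) (hA : ∀ i, MeasurableSet (A i))
    (hL : ∀ ω, L ω = {r | ∃ i, ω ∈ A i ∧ y i ω = r}) {p c : Ω → Pt} (hp : Measurable p)
    (hc : Measurable c) : MeasurableSet {ω | c ω ∈ maximizers (L ω) (p ω)} := by
  have h1 : MeasurableSet {ω | ∃ r ∈ L ω, r = c ω} :=
    measurableSet_exists_mem hA hL fun i => measurableSet_eq_fun (hy i) hc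
  have h2 : MeasurableSet {ω | (p ω).1 < (c ω).1} := measurableSet_lt hp.fst hc.fst
  have h3 : MeasurableSet
      {ω | ∀ r ∈ L ω, (p ω).1 < r.1 → incline (p ω) r ≤ incline (p ω) (c ω)} := by
    refine measurableSet_forall_mem hA hL fun i => ?_
    exact (measurableSet_lt hp.fst (hy i).fst).imp
      (measurableSet_le (measurable_incline hp (hy i)) (measurable_incline hp hc))
  convert h1.inter (h2.inter h3) using 1
  ext ω
  simp only [maximizers, Set.mem_ofPred_eq, Set.mem_inter_iff, exists_eq_right]

lemma measurableSet_isBlockingBuilding (hy : ∀ i, Measurable (y i)) (hA : ∀ i, MeasurableSet (A i))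
    (hL : ∀ ω, L ω = {r | ∃ i, ω ∈ A i ∧ y i ω = r}) {p c : Ω → Pt} (hp : Measurable p)
    (hc : Measurable c) : MeasurableSet {ω | IsBlockingBuilding (L ω) (p ω) (c ω)} := by
  have h : MeasurableSet {ω | ∀ r ∈ L ω, r ∈ maximizers (L ω) (p ω) → (c ω).1 ≤ r.1} :=
    measurableSet_forall_mem hA hL fun i =>
      (measurableSet_mem_maximizers hy hA hL hp (hy i)).imp (measurableSet_le hc.fst (hy i).fst)
  convert (measurableSet_mem_maximizers hy hA hL hp hc).inter h using 1
  ext ω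
  constructor
  · exact fun h => ⟨h.1, fun r _ hr => h.2 r hr⟩
  · exact fun h => ⟨h.1, fun r hr => h.2 r hr.1 hr⟩

/-- The zone of eventual relaying in a countable random landscape is measurable. -/
theorem measurableSet_mem_zone (hy : ∀ i, Measurable (y i)) (hA : ∀ i, MeasurableSet (A i))
    (hL : ∀ ω, L ω = {r | ∃ i, ω ∈ A i ∧ y i ω = r}) (b : Pt) {p : Ω → Pt} (hp : Measurable p) :
    MeasurableSet {ω | p ω ∈ zone (L ω) b} := by
  simp only [mem_zone_iff_exists_relayStep, Set.ofPred_exists]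
  refine MeasurableSet.iUnion fun n => ?_
  induction n generalizing p with
  | zero => exact measurableSet_eq_fun hp measurable_const
  | succ n ih =>
    exact measurableSet_exists_mem hA hL fun i =>
      (measurableSet_isBlockingBuilding hy hA hL hp (hy i)).inter (ih (hy i))

end

lemma IsLandscape.countable {L : Set Pt} (h : IsLandscape L) : L.Countable := by
  refine Set.countable_of_injective_of_countable_image h.injOn_base ?_
  have : Prod.fst '' L ⊆ ⋃ n : ℕ, (Prod.fst '' L) ∩ Set.Icc (-(n : ℝ)) n := by
    intro x hx
    obtain ⟨n, hn⟩ := exists_nat_ge |x|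
    exact Set.mem_iUnion.mpr ⟨n, hx, abs_le.mp hn⟩
  exact (Set.countable_iUnion fun n => (h.finite_bases _ _).countable).mono this

theorem measurableSet_mem_zone_splice {Ω : Type*} [MeasurableSpace Ω] {Y : ℕ → Ω → Pt}
    (hY : ∀ n, Measurable (Y n)) {L' : Set Pt} (hL' : IsLandscape L') (α : ℝ) (b : Pt)
    {p : Ω → Pt} (hp : Measurable p) :
    MeasurableSet {ω | p ω ∈ zone (splice L' (Set.range fun n => Y n ω) α) b} := by
  have : Countable L' := hL'.countable.to_subtype
  refine measurableSet_mem_zone (ι := ℕ ⊕ L') (y := Sum.elim Y fun r _ => r)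
    (A := Sum.elim (fun n => {ω | (Y n ω).1 < α}) fun r => {_ω | α ≤ (r : Pt).1})
    ?_ ?_ ?_ b hp
  · rintro (n | r)
    · exact hY n
    · exact measurable_const
  · rintro (n | r)
    · exact measurableSet_lt (hY n).fst measurable_const
    · exact MeasurableSet.const _
  · intro ω
    ext r
    simp only [splice, Set.mem_union, Set.mem_ofPred_eq, Sum.exists, Sum.elim_inl, Sum.elim_inr,
      Set.mem_range]
    constructor
    · rintro (⟨hr, h⟩ | ⟨⟨n, rfl⟩, h⟩)
      · exact Or.inr ⟨⟨r, hr⟩, h, rfl⟩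
      · exact Or.inl ⟨n, h, rfl⟩
    · rintro (⟨n, h, rfl⟩ | ⟨r, h, rfl⟩)
      · exact Or.inr ⟨⟨n, rfl⟩, h⟩
      · exact Or.inl ⟨r.2, h⟩

/-! ### Poisson points beyond an independent record -/

/-- The numbers of points of the random sequence `Y` in disjoint measurable sets are independent
Poisson variables with the means prescribed by `Λ`. -/
structure HasPoissonHits {Ω E : Type*} [MeasurableSpace Ω] [MeasurableSpace E] (P : Measure Ω)
    (Λ : Measure E) (Y : ℕ → Ω → E) : Prop where
  measurable : ∀ n, Measurable (Y n)
  measure_eq : ∀ (k : ℕ) (B : Fin k → Set E) (n : Fin k → ℕ), (∀ i, MeasurableSet (B i)) →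
    Pairwise (Function.onFun Disjoint B) →
    P {ω | ∀ i, hits (fun m => Y m ω) (B i) = n i}
      = ∏ i, ENNReal.ofReal (poissonProb (Λ (B i)) (n i))

/-- The supremum of `κ` over the points of the sequence `y` in `T`. -/
def record {E : Type*} (κ : E → ℝ≥0∞) (T : Set E) (y : ℕ → E) : ℝ≥0∞ := ⨆ n, T.indicator κ (y n)

lemma record_le_iff {E : Type*} {κ : E → ℝ≥0∞} {T : Set E} {y : ℕ → E} {r : ℝ≥0∞} :
    record κ T y ≤ r ↔ ∀ n, y n ∈ T → κ (y n) ≤ r := by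
  simp only [record, iSup_le_iff]
  refine forall_congr' fun n => ?_
  by_cases h : y n ∈ T <;> simp [h]

/-- This turns the law of the record into a void probability. -/
lemma record_le_iff_hits {E : Type*} {κ : E → ℝ≥0∞} {T : Set E} {y : ℕ → E} {r : ℝ≥0∞} :
    record κ T y ≤ r ↔ hits y (T ∩ κ ⁻¹' Set.Ioi r) = 0 := by
  rw [record_le_iff, hits, Set.encard_eq_zero, Set.eq_empty_iff_forall_notMem]
  refine forall_congr' fun n => ?_
  simp [not_lt]

lemma poissonProb_zero (r : ℝ≥0∞) : ENNReal.ofReal (poissonProb r 0) = expNeg r := by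
  induction r with
  | top => simp
  | coe r => rw [poissonProb_coe, expNeg_coe]; simp

lemma continuousAt_poissonProb {r : ℝ≥0∞} (hr : r ≠ ⊤) (n : ℕ) :
    ContinuousAt (fun s => poissonProb s n) r := by
  have h : (fun s : ℝ≥0∞ => Real.exp (-s.toReal) * s.toReal ^ n / n.factorial)
      =ᶠ[𝓝 r] fun s => poissonProb s n := by
    filter_upwards [gt_mem_nhds (lt_top_iff_ne_top.mpr hr)] with s hs
    lift s to ℝ≥0 using hs.ne
    rw [poissonProb_coe]
    simp
  refine ContinuousAt.congr ?_ h
  have := ENNReal.continuousAt_toReal hr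
  fun_prop

lemma measurable_poissonProb (n : ℕ) : Measurable fun s => poissonProb s n := by
  have h : (fun s => poissonProb s n) = fun s : ℝ≥0∞ => if s = ⊤ then 0 else
      Real.exp (-s.toReal) * s.toReal ^ n / n.factorial := by
    ext s
    induction s with
    | top => simp
    | coe s => simp [poissonProb_coe]
  rw [h]
  exact Measurable.ite (measurableSet_singleton _) measurable_const (by fun_prop)

/-- The event that the numbers of points in the sets `B i ∩ S ∩ {r ≤ κ}` are `n i`. -/
def countEvent {Ω E : Type*} (Y : ℕ → Ω → E) (κ : E → ℝ≥0∞) (S : Set E) {k : ℕ} (B : Fin k → Set E)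
    (n : Fin k → ℕ) (r : ℝ≥0∞) : Set Ω :=
  {ω | ∀ i, hits (fun m => Y m ω) (B i ∩ (S ∩ κ ⁻¹' Set.Ici r)) = n i}

lemma exists_simpleFunc_monotone_tendsto : ∃ φ : ℕ → SimpleFunc ℝ≥0∞ ℝ≥0∞,
    (∀ r, Monotone fun j => φ j r) ∧ ∀ r, Tendsto (fun j => φ j r) atTop (𝓝 r) := by
  have h := fun r : ℝ≥0∞ => SimpleFunc.iSup_eapprox_apply (f := fun r : ℝ≥0∞ => r) measurable_id r
  have h2 := SimpleFunc.monotone_eapprox (fun r : ℝ≥0∞ => r)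
  generalize SimpleFunc.eapprox (fun r : ℝ≥0∞ => r) = φ at h h2
  have h3 : ∀ r, Monotone fun j => φ j r := fun r j k hjk => h2 hjk r
  refine ⟨φ, h3, fun r => ?_⟩
  have := tendsto_atTop_iSup (h3 r)
  rwa [h r] at this

/-- Only finitely many points lie beyond a positive level, so levels increasing to r > 0 eventually
select the same points as r. For r = 0 the levels are all 0. Approximation from below is essential,
since the selection `r ≤ κ` is closed. -/
lemma eventually_mem_countEvent_iff {Ω E : Type*} {Y : ℕ → Ω → E} {κ : E → ℝ≥0∞} {S : Set E}
    {ω : Ω} (hω : ∀ r, 0 < r → {n | r ≤ κ (Y n ω)}.Finite)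
    {k : ℕ} (B : Fin k → Set E) (n : Fin k → ℕ) {s : ℕ → ℝ≥0∞} (hs : Monotone s) {r : ℝ≥0∞}
    (hlim : Tendsto s atTop (𝓝 r)) :
    ∀ᶠ j in atTop, (ω ∈ countEvent Y κ S B n (s j) ↔
      ω ∈ countEvent Y κ S B n r) := by
  have hle : ∀ j, s j ≤ r := fun j => hs.ge_of_tendsto hlim j
  rcases eq_or_ne r 0 with rfl | hr
  · refine Eventually.of_forall fun j => ?_
    rw [le_zero_iff.mp (hle j)]
  have hpos := pos_iff_ne_zero.mpr hr
  obtain ⟨j₀, hj₀⟩ := (hlim.eventually (lt_mem_nhds hpos)).exists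
  have hfin := hω _ hj₀
  have hev : ∀ᶠ j in atTop, ∀ m ∈ {m | s j₀ ≤ κ (Y m ω)},
      (s j ≤ κ (Y m ω) ↔ r ≤ κ (Y m ω)) := by
    rw [eventually_all_finite hfin]
    intro m _
    rcases le_or_gt r (κ (Y m ω)) with h | h
    · exact Eventually.of_forall fun j => ⟨fun _ => h, fun _ => (hle j).trans h⟩
    · filter_upwards [hlim.eventually (lt_mem_nhds h)] with j hj
      exact ⟨fun h' => absurd hj (not_lt.mpr h'), fun h' => absurd h (not_lt.mpr h')⟩
  filter_upwards [hev, eventually_ge_atTop j₀] with j hj hjj₀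
  have hset : ∀ m, s j ≤ κ (Y m ω) ↔ r ≤ κ (Y m ω) := by
    intro m
    by_cases hm : s j₀ ≤ κ (Y m ω)
    · exact hj m hm
    · have h1 := hs hjj₀
      exact ⟨fun h => absurd (h1.trans h) hm, fun h => absurd ((hle j₀).trans h) hm⟩
  simp only [countEvent, hits, Set.mem_inter_iff, Set.mem_preimage, Set.mem_Ici, hset,
    Set.mem_ofPred_eq]

section

variable {Ω E : Type*} [MeasurableSpace Ω] [MeasurableSpace E] {P : Measure Ω}
  {Λ : Measure E} {Y : ℕ → Ω → E} {κ : E → ℝ≥0∞} {S T : Set E}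

lemma measurable_record (hY : ∀ n, Measurable (Y n)) (hκ : Measurable κ) (hT : MeasurableSet T) :
    Measurable fun ω => record κ T fun n => Y n ω :=
  Measurable.iSup fun n => (hκ.indicator hT).comp (hY n)

/-- The product of the Poisson weights of the sets `B i ∩ S ∩ {r ≤ κ}`. -/
def countWeight (Λ : Measure E) (κ : E → ℝ≥0∞) (S : Set E) {k : ℕ} (B : Fin k → Set E)
    (n : Fin k → ℕ) (r : ℝ≥0∞) : ℝ :=
  ∏ i, poissonProb (Λ (B i ∩ (S ∩ κ ⁻¹' Set.Ici r))) (n i)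

lemma countWeight_nonneg {k : ℕ} (B : Fin k → Set E) (n : Fin k → ℕ) (r : ℝ≥0∞) :
    0 ≤ countWeight Λ κ S B n r :=
  Finset.prod_nonneg fun _ _ => poissonProb_nonneg _ _

lemma countWeight_le_one {k : ℕ} (B : Fin k → Set E) (n : Fin k → ℕ) (r : ℝ≥0∞) :
    countWeight Λ κ S B n r ≤ 1 :=
  Finset.prod_le_one (fun _ _ => poissonProb_nonneg _ _) fun _ _ => poissonProb_le_one _ _

lemma measurable_countWeight (Λ : Measure E) (κ : E → ℝ≥0∞) (S : Set E) {k : ℕ}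
    (B : Fin k → Set E) (n : Fin k → ℕ) : Measurable (countWeight Λ κ S B n) := by
  refine Finset.measurable_prod _ fun i _ => (measurable_poissonProb (n i)).comp ?_
  refine Antitone.measurable fun r s hrs => measure_mono ?_
  exact Set.inter_subset_inter_right _ (Set.inter_subset_inter_right _
    (Set.preimage_mono (Set.Ici_subset_Ici.mpr hrs)))

lemma measurableSet_countEvent_comp (hY : ∀ n, Measurable (Y n)) (hκ : Measurable κ)
    (hS : MeasurableSet S) {k : ℕ} {B : Fin k → Set E} (hB : ∀ i, MeasurableSet (B i))
    (n : Fin k → ℕ) {ρ : Ω → ℝ≥0∞} (hρ : Measurable ρ) :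
    MeasurableSet {ω | ω ∈ countEvent Y κ S B n (ρ ω)} := by
  have h : ∀ i, Measurable fun ω =>
      hits (fun m => Y m ω) (B i ∩ (S ∩ κ ⁻¹' Set.Ici (ρ ω))) := fun i =>
    measurable_encard_setOf
      (A := fun m => Y m ⁻¹' (B i) ∩ (Y m ⁻¹' S ∩ {ω | ρ ω ≤ κ (Y m ω)})) fun m =>
        (hY m (hB i)).inter ((hY m hS).inter (measurableSet_le hρ (hκ.comp (hY m))))
  have heq : {ω | ω ∈ countEvent Y κ S B n (ρ ω)} =
      ⋂ i, {ω | hits (fun m => Y m ω) (B i ∩ (S ∩ κ ⁻¹' Set.Ici (ρ ω))) = n i} := by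
    ext ω
    simp [countEvent]
  rw [heq]
  exact MeasurableSet.iInter fun i => h i (measurableSet_singleton _)

lemma HasPoissonHits.measure_record_le (h : HasPoissonHits P Λ Y) (hκ : Measurable κ)
    (hT : MeasurableSet T) (r : ℝ≥0∞) :
    P {ω | record κ T (fun n => Y n ω) ≤ r} = expNeg (Λ (T ∩ κ ⁻¹' Set.Ioi r)) := by
  have := h.measure_eq 1 (fun _ => T ∩ κ ⁻¹' Set.Ioi r) (fun _ => 0)
    (fun _ => hT.inter (hκ measurableSet_Ioi)) (fun i j hij => absurd (Subsingleton.elim i j) hij)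
  simpa [record_le_iff_hits, poissonProb_zero] using this

lemma HasPoissonHits.measure_countEvent (h : HasPoissonHits P Λ Y) (hκ : Measurable κ)
    (hS : MeasurableSet S) {k : ℕ} {B : Fin k → Set E} (hB : ∀ i, MeasurableSet (B i))
    (hd : Pairwise (Function.onFun Disjoint B)) (n : Fin k → ℕ) (r : ℝ≥0∞) :
    P (countEvent Y κ S B n r) = ENNReal.ofReal (countWeight Λ κ S B n r) := by
  rw [countWeight, ENNReal.ofReal_prod_of_nonneg fun _ _ => poissonProb_nonneg _ _]
  exact h.measure_eq k _ n (fun i => (hB i).inter (hS.inter (hκ measurableSet_Ici)))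
    fun i j hij => (hd hij).mono Set.inter_subset_left Set.inter_subset_left

/-- The bound on the record is one more count, equal to 0, in a set contained in T and hence
disjoint from the sets contained in S. -/
lemma HasPoissonHits.measure_countEvent_inter_le (h : HasPoissonHits P Λ Y) (hκ : Measurable κ)
    (hS : MeasurableSet S) (hT : MeasurableSet T) (hST : Disjoint S T) {k : ℕ} {B : Fin k → Set E}
    (hB : ∀ i, MeasurableSet (B i)) (hd : Pairwise (Function.onFun Disjoint B)) (n : Fin k → ℕ)
    (r s : ℝ≥0∞) :
    P ({ω | record κ T (fun n => Y n ω) ≤ s} ∩ countEvent Y κ S B n r) =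
      P {ω | record κ T (fun n => Y n ω) ≤ s} * P (countEvent Y κ S B n r) := by
  have hsub : ∀ i, B i ∩ (S ∩ κ ⁻¹' Set.Ici r) ⊆ S := fun i e he => he.2.1
  have := h.measure_eq (k + 1)
    (Fin.cons (T ∩ κ ⁻¹' Set.Ioi s) fun i => B i ∩ (S ∩ κ ⁻¹' Set.Ici r)) (Fin.cons 0 n) ?_ ?_
  · rw [Fin.prod_univ_succ] at this
    simp only [Fin.cons_zero, Fin.cons_succ, poissonProb_zero] at this
    rw [h.measure_countEvent hκ hS hB hd, h.measure_record_le hκ hT, countWeight,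
      ENNReal.ofReal_prod_of_nonneg fun _ _ => poissonProb_nonneg _ _, ← this]
    congr 1
    ext ω
    simp only [countEvent, Set.mem_inter_iff, Set.mem_ofPred_eq, Fin.forall_fin_succ, Fin.cons_zero,
      Fin.cons_succ, record_le_iff_hits, Nat.cast_zero]
  · refine Fin.cases ?_ fun i => ?_
    · exact hT.inter (hκ measurableSet_Ioi)
    · exact (hB i).inter (hS.inter (hκ measurableSet_Ici))
  · refine Fin.cases ?_ fun i => ?_
    · refine Fin.cases (fun h => absurd rfl h) fun j _ => ?_
      exact (hST.symm.mono Set.inter_subset_left (hsub j))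
    · refine Fin.cases (fun _ => ?_) fun j hij => ?_
      · exact (hST.mono (hsub i) Set.inter_subset_left)
      · exact (hd fun hij' => hij (congrArg _ hij')).mono Set.inter_subset_left
          Set.inter_subset_left

lemma HasPoissonHits.measure_countEvent_inter [IsProbabilityMeasure P] (h : HasPoissonHits P Λ Y)
    (hκ : Measurable κ)
    (hS : MeasurableSet S) (hT : MeasurableSet T) (hST : Disjoint S T) {k : ℕ} {B : Fin k → Set E}
    (hB : ∀ i, MeasurableSet (B i)) (hd : Pairwise (Function.onFun Disjoint B)) (n : Fin k → ℕ)
    (r : ℝ≥0∞) {K : Set ℝ≥0∞} (hK : MeasurableSet K) :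
    P (((fun ω => record κ T (fun n => Y n ω)) ⁻¹' K) ∩ countEvent Y κ S B n r) =
      P ((fun ω => record κ T (fun n => Y n ω)) ⁻¹' K) * P (countEvent Y κ S B n r) := by
  have hρ := measurable_record h.measurable hκ hT
  have hE : MeasurableSet (countEvent Y κ S B n r) :=
    measurableSet_countEvent_comp h.measurable hκ hS hB n measurable_const
  have heq : (P.restrict (countEvent Y κ S B n r)).map (fun ω => record κ T fun n => Y n ω)
      = P (countEvent Y κ S B n r) • P.map (fun ω => record κ T fun n => Y n ω) := by
    have hfin : IsFiniteMeasure
        (P (countEvent Y κ S B n r) • P.map (fun ω => record κ T fun n => Y n ω)) :=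
      Measure.smul_finite _ (measure_ne_top _ _)
    -- Half lines determine a finite measure, which extends independence from the events `record ≤
    -- s` to all events of the record.
    refine Measure.ext_of_Iic _ _ fun s => ?_
    rw [Measure.map_apply hρ measurableSet_Iic, Measure.restrict_apply (hρ measurableSet_Iic),
      Measure.smul_apply, Measure.map_apply hρ measurableSet_Iic, smul_eq_mul, mul_comm]
    exact h.measure_countEvent_inter_le hκ hS hT hST hB hd n r s
  have := congrFun (congrArg DFunLike.coe heq) K
  rwa [Measure.map_apply hρ hK, Measure.restrict_apply (hρ hK), Measure.smul_apply,
    Measure.map_apply hρ hK, smul_eq_mul, mul_comm] at this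

/-- A level with finitely many values is constant on each piece of a finite partition into events of
ρ, and on each piece independence from the counts at that fixed level applies. -/
lemma HasPoissonHits.measure_countEvent_simpleFunc [IsProbabilityMeasure P]
    (h : HasPoissonHits P Λ Y) (hκ : Measurable κ)
    (hS : MeasurableSet S) {k : ℕ} {B : Fin k → Set E}
    (hB : ∀ i, MeasurableSet (B i)) (hd : Pairwise (Function.onFun Disjoint B)) (n : Fin k → ℕ)
    {ρ : Ω → ℝ≥0∞} (hρ : Measurable ρ)
    (hind : ∀ r K, MeasurableSet K → P (ρ ⁻¹' K ∩ countEvent Y κ S B n r)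
      = P (ρ ⁻¹' K) * P (countEvent Y κ S B n r))
    (φ : SimpleFunc ℝ≥0∞ ℝ≥0∞) {K : Set ℝ≥0∞} (hK : MeasurableSet K) :
    ∫⁻ ω in ρ ⁻¹' K,
        {ω | ω ∈ countEvent Y κ S B n (φ (ρ ω))}.indicator 1 ω ∂P =
      ∫⁻ ω in ρ ⁻¹' K,
        ENNReal.ofReal (countWeight Λ κ S B n (φ (ρ ω))) ∂P := by
  have hE : MeasurableSet {ω | ω ∈ countEvent Y κ S B n (φ (ρ ω))} :=
    measurableSet_countEvent_comp h.measurable hκ hS hB n (φ.measurable.comp hρ)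
  rw [lintegral_indicator_one hE, Measure.restrict_apply hE]
  have h1 : {ω | ω ∈ countEvent Y κ S B n (φ (ρ ω))} ∩ ρ ⁻¹' K =
      ⋃ c ∈ φ.range, (ρ ⁻¹' (K ∩ φ ⁻¹' {c}) ∩ countEvent Y κ S B n c) := by
    ext ω
    simp only [Set.mem_inter_iff, Set.mem_ofPred_eq, Set.mem_iUnion, Set.mem_preimage,
      Set.mem_singleton_iff, exists_prop]
    constructor
    · rintro ⟨hω, hK⟩
      exact ⟨φ (ρ ω), φ.mem_range_self _, ⟨hK, rfl⟩, hω⟩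
    · rintro ⟨c, -, ⟨hK, rfl⟩, hω⟩
      exact ⟨hω, hK⟩
  have h2 : ∫⁻ ω in ρ ⁻¹' K, ENNReal.ofReal (countWeight Λ κ S B n (φ (ρ ω))) ∂P =
      ∑ c ∈ φ.range, ENNReal.ofReal (countWeight Λ κ S B n c) * P (ρ ⁻¹' (K ∩ φ ⁻¹' {c})) := by
    rw [← lintegral_map (f := fun r => ENNReal.ofReal (countWeight Λ κ S B n (φ r)))
      ((measurable_countWeight Λ κ S B n).comp φ.measurable).ennreal_ofReal hρ]
    have := SimpleFunc.map_lintegral (μ := (P.restrict (ρ ⁻¹' K)).map ρ)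
      (fun c => ENNReal.ofReal (countWeight Λ κ S B n c)) φ
    rw [← SimpleFunc.lintegral_eq_lintegral] at this
    refine this.trans (Finset.sum_congr rfl fun c _ => ?_)
    have hc := φ.measurableSet_preimage {c}
    rw [Measure.map_apply hρ hc, Measure.restrict_apply (hρ hc), Set.inter_comm K,
      Set.preimage_inter]
  rw [h2, h1, measure_biUnion_finset]
  · refine Finset.sum_congr rfl fun c _ => ?_
    rw [hind c _ (hK.inter (φ.measurableSet_preimage {c})), h.measure_countEvent hκ hS hB hd, mul_comm]
  · intro c _ d _ hcd
    refine Set.disjoint_left.mpr fun ω hω hω' => hcd ?_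
    have e1 : φ (ρ ω) = c := hω.1.2
    have e2 : φ (ρ ω) = d := hω'.1.2
    rw [← e1, ← e2]
  · intro c _
    exact (hρ (hK.inter (φ.measurableSet_preimage {c}))).inter
      (measurableSet_countEvent_comp h.measurable hκ hS hB n measurable_const)

/-- Analytic counterpart of the stabilization of the counts: measures of decreasing sets converge,
as the shade beyond a positive level has finite mass. Nothing is required at level 0, where the
approximations are constant. -/
lemma tendsto_countWeight (hκ : Measurable κ) (hS : MeasurableSet S)
    (hΛ : ∀ r, 0 < r → Λ (S ∩ κ ⁻¹' Set.Ici r) ≠ ⊤)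
    {k : ℕ} {B : Fin k → Set E} (hB : ∀ i, MeasurableSet (B i)) (n : Fin k → ℕ) {s : ℕ → ℝ≥0∞} (hs : Monotone s) {r : ℝ≥0∞}
    (hlim : Tendsto s atTop (𝓝 r)) :
    Tendsto (fun j => countWeight Λ κ S B n (s j)) atTop
      (𝓝 (countWeight Λ κ S B n r)) := by
  have hle : ∀ j, s j ≤ r := fun j => hs.ge_of_tendsto hlim j
  rcases eq_or_ne r 0 with rfl | hr
  · simp_rw [le_zero_iff.mp (hle _)]
    exact tendsto_const_nhds
  have hpos := pos_iff_ne_zero.mpr hr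
  obtain ⟨j₀, hj₀⟩ := (hlim.eventually (lt_mem_nhds hpos)).exists
  refine tendsto_finsetProd _ fun i _ => ?_
  have hfin : ∀ x, 0 < x → Λ (B i ∩ (S ∩ κ ⁻¹' Set.Ici x)) ≠ ⊤ := fun x hx =>
    ne_top_of_le_ne_top (hΛ x hx) (measure_mono Set.inter_subset_right)
  refine (continuousAt_poissonProb (hfin r hpos) (n i)).tendsto.comp ?_
  have hinter : B i ∩ (S ∩ κ ⁻¹' Set.Ici r)
      = ⋂ j, B i ∩ (S ∩ κ ⁻¹' Set.Ici (s j)) := by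
    ext e
    simp only [Set.mem_inter_iff, Set.mem_iInter, Set.mem_preimage, Set.mem_Ici]
    constructor
    · exact fun h j => ⟨h.1, h.2.1, (hle j).trans h.2.2⟩
    · exact fun h => ⟨(h 0).1, (h 0).2.1, le_of_tendsto' hlim fun j => (h j).2.2⟩
  rw [hinter]
  refine tendsto_measure_iInter_atTop
    (fun j => ((hB i).inter (hS.inter (hκ measurableSet_Ici))).nullMeasurableSet) ?_
    ⟨j₀, hfin _ hj₀⟩
  intro j l hjl
  refine Set.inter_subset_inter_right _ (Set.inter_subset_inter_right _ (Set.preimage_mono ?_))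
  exact Set.Ici_subset_Ici.mpr (hs hjl)

/-- The numbers of points of `S ∩ {ρ ≤ κ}` for an independent random level `ρ`. -/
theorem HasPoissonHits.lintegral_countEvent_comp [IsProbabilityMeasure P]
    (h : HasPoissonHits P Λ Y) (hκ : Measurable κ)
    (hS : MeasurableSet S)
    (hΛ : ∀ r, 0 < r → Λ (S ∩ κ ⁻¹' Set.Ici r) ≠ ⊤)
    (hfin : ∀ᵐ ω ∂P, ∀ r, 0 < r → {n | r ≤ κ (Y n ω)}.Finite)
    {k : ℕ} {B : Fin k → Set E}
    (hB : ∀ i, MeasurableSet (B i)) (hd : Pairwise (Function.onFun Disjoint B)) (n : Fin k → ℕ)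
    {ρ : Ω → ℝ≥0∞} (hρ : Measurable ρ)
    (hind : ∀ r K, MeasurableSet K → P (ρ ⁻¹' K ∩ countEvent Y κ S B n r)
      = P (ρ ⁻¹' K) * P (countEvent Y κ S B n r))
    {K : Set ℝ≥0∞} (hK : MeasurableSet K) :
    ∫⁻ ω in ρ ⁻¹' K,
        {ω | ω ∈ countEvent Y κ S B n (ρ ω)}.indicator 1 ω ∂P =
      ∫⁻ ω in ρ ⁻¹' K,
        ENNReal.ofReal (countWeight Λ κ S B n (ρ ω)) ∂P := by
  obtain ⟨φ, hφe, hφw⟩ : ∃ φ : ℕ → SimpleFunc ℝ≥0∞ ℝ≥0∞,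
      (∀ᵐ ω ∂P, ∀ᶠ j in atTop, (ω ∈ countEvent Y κ S B n (φ j (ρ ω)) ↔
        ω ∈ countEvent Y κ S B n (ρ ω))) ∧
      ∀ r, Tendsto (fun j => countWeight Λ κ S B n (φ j r)) atTop
        (𝓝 (countWeight Λ κ S B n r)) :=
    let ⟨φ, hφ, hlim⟩ := exists_simpleFunc_monotone_tendsto
    ⟨φ, hfin.mono fun ω hω => eventually_mem_countEvent_iff hω B n (hφ _) (hlim _),
      fun r => tendsto_countWeight hκ hS hΛ hB n (hφ r) (hlim r)⟩
  have hm1 : ∀ j, MeasurableSet {ω | ω ∈ countEvent Y κ S B n (φ j (ρ ω))} := fun j =>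
    measurableSet_countEvent_comp h.measurable hκ hS hB n ((φ j).measurable.comp hρ)
  have hm2 : ∀ j, Measurable fun ω => countWeight Λ κ S B n (φ j (ρ ω)) := fun j =>
    (measurable_countWeight Λ κ S B n).comp ((φ j).measurable.comp hρ)
  refine tendsto_nhds_unique (f := fun j => ∫⁻ ω in ρ ⁻¹' K,
    {ω | ω ∈ countEvent Y κ S B n (φ j (ρ ω))}.indicator 1 ω ∂P) (l := atTop) ?_ ?_
  · refine tendsto_lintegral_of_dominated_convergence (fun _ => 1) ?_ ?_ ?_ ?_
    · exact fun j => measurable_one.indicator (hm1 j)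
    · refine fun j => Eventually.of_forall fun ω => ?_
      exact Set.indicator_le_self' (fun _ _ => zero_le) ω
    · simp
    · filter_upwards [ae_restrict_of_ae hφe] with ω hω
      refine tendsto_const_nhds.congr' ?_
      filter_upwards [hω] with j hj
      by_cases hmem : ω ∈ countEvent Y κ S B n (ρ ω)
      · rw [Set.indicator_of_mem (by exact hmem), Set.indicator_of_mem (by exact hj.mpr hmem)]
      · rw [Set.indicator_of_notMem (by exact hmem),
          Set.indicator_of_notMem (by exact fun h' => hmem (hj.mp h'))]
  · have e : ∀ j, ∫⁻ ω in ρ ⁻¹' K,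
        {ω | ω ∈ countEvent Y κ S B n (φ j (ρ ω))}.indicator 1 ω ∂P = _ :=
      fun j => h.measure_countEvent_simpleFunc hκ hS hB hd n hρ hind (φ j) hK
    simp_rw [e]
    refine tendsto_lintegral_of_dominated_convergence (fun _ => 1) ?_ ?_ ?_ ?_
    · exact fun j => (hm2 j).ennreal_ofReal
    · exact fun j => Eventually.of_forall fun ω =>
        ENNReal.ofReal_le_one.mpr (countWeight_le_one _ _ _)
    · simp
    · exact Eventually.of_forall fun ω => ENNReal.tendsto_ofReal (hφw (ρ ω))

end

/-- Conditionally on a σ-algebra that is, up to null sets, generated by the record of `T`, the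
numbers of points of `S` beyond the record are independent Poisson variables. -/
theorem HasPoissonHits.condExp_countEvent_record {Ω E : Type*} {m : MeasurableSpace Ω}
    [mΩ : MeasurableSpace Ω] [MeasurableSpace E] {P : Measure Ω}
    {Λ : Measure E} {Y : ℕ → Ω → E} {κ : E → ℝ≥0∞} {S T : Set E} [IsProbabilityMeasure P]
    (h : HasPoissonHits P Λ Y) (hκ : Measurable κ)
    (hS : MeasurableSet S) (hT : MeasurableSet T) (hST : Disjoint S T)
    (hΛ : ∀ r, 0 < r → Λ (S ∩ κ ⁻¹' Set.Ici r) ≠ ⊤)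
    (hfin : ∀ᵐ ω ∂P, ∀ r, 0 < r → {n | r ≤ κ (Y n ω)}.Finite)
    (hm : m ≤ mΩ)
    (hmρ : ∀ A, MeasurableSet[m] A → ∃ K, MeasurableSet K ∧
      A =ᵐ[P] (fun ω => record κ T (fun n => Y n ω)) ⁻¹' K)
    {k : ℕ} {B : Fin k → Set E}
    (hB : ∀ i, MeasurableSet (B i)) (hd : Pairwise (Function.onFun Disjoint B)) (n : Fin k → ℕ)
    (hmeas : AEStronglyMeasurable[m]
      (fun ω => countWeight Λ κ S B n (record κ T fun n => Y n ω)) P) :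
    P[{ω | ω ∈ countEvent Y κ S B n (record κ T fun n => Y n ω)}.indicator (fun _ => (1 : ℝ)) | m]
      =ᵐ[P] fun ω => countWeight Λ κ S B n (record κ T fun n => Y n ω) := by
  have hρ := measurable_record h.measurable hκ hT
  set ρ : Ω → ℝ≥0∞ := fun ω => record κ T fun n => Y n ω with hρdef
  have hE := measurableSet_countEvent_comp h.measurable hκ hS hB n hρ
  have hwm : Measurable fun ω => countWeight Λ κ S B n (ρ ω) :=
    (measurable_countWeight Λ κ S B n).comp hρ
  have hint : Integrable (fun ω => countWeight Λ κ S B n (ρ ω)) P := by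
    refine Integrable.of_bound hwm.aestronglyMeasurable 1 (Eventually.of_forall fun ω => ?_)
    rw [Real.norm_of_nonneg (countWeight_nonneg _ _ _)]
    exact countWeight_le_one _ _ _
  refine (ae_eq_condExp_of_forall_setIntegral_eq hm ((integrable_const 1).indicator hE)
    (fun s _ _ => hint.integrableOn) ?_ hmeas).symm
  intro A hA _
  obtain ⟨K, hK, hAK⟩ := hmρ A hA
  -- Both integrals ignore null sets, so the conditioning event may be replaced by an event of the
  -- record.
  rw [setIntegral_congr_set hAK, setIntegral_congr_set hAK]
  have key := h.lintegral_countEvent_comp hκ hS hΛ hfin hB hd n hρ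
    (fun r K hK => h.measure_countEvent_inter hκ hS hT hST hB hd n r hK) hK
  rw [integral_eq_lintegral_of_nonneg_ae (Eventually.of_forall fun ω => countWeight_nonneg _ _ _)
    hwm.aestronglyMeasurable, ← key, integral_indicator_const _ hE, lintegral_indicator_one hE]
  simp only [measureReal_def, smul_eq_mul, mul_one]

/-! ### Proximity to the building as the level function -/

/-- The inverse of the horizontal distance to `b`, for the points to the left of `b`. -/
def proximity (b p : Pt) : ℝ≥0∞ := ENNReal.ofReal (b.1 - p.1)⁻¹

lemma measurable_proximity (b : Pt) : Measurable (proximity b) :=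
  ((measurable_const.sub measurable_fst).inv).ennreal_ofReal

lemma proximity_le_iff {b p r : Pt} (hp : p.1 < b.1) (hr : r.1 < b.1) :
    proximity b r ≤ proximity b p ↔ r.1 ≤ p.1 := by
  have hp' := sub_pos.mpr hp
  have hr' := sub_pos.mpr hr
  rw [proximity, proximity, ENNReal.ofReal_le_ofReal_iff (inv_pos.mpr hp').le,
    inv_le_inv₀ hr' hp', sub_le_sub_iff_left]

/-- Points not to the left of b have proximity 0, because the inverse of 0 is 0 and `ENNReal.ofReal`
truncates negative values. A positive level therefore confines the points to a bounded strip left of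
b. -/
lemma le_of_le_proximity {b p : Pt} {r : ℝ≥0∞} (hr : 0 < r) (h : r ≤ proximity b p) :
    p.1 < b.1 ∧ b.1 - r.toReal⁻¹ ≤ p.1 := by
  have hpos : 0 < (b.1 - p.1)⁻¹ := ENNReal.ofReal_pos.mp (hr.trans_le h)
  have hlt : 0 < b.1 - p.1 := inv_pos.mp hpos
  have hrtop : r ≠ ⊤ := ne_top_of_le_ne_top ENNReal.ofReal_ne_top h
  have hr' : r.toReal ≤ (b.1 - p.1)⁻¹ := by
    have := ENNReal.toReal_mono ENNReal.ofReal_ne_top h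
    rwa [ENNReal.toReal_ofReal hpos.le] at this
  have hr0 : 0 < r.toReal := ENNReal.toReal_pos hr.ne' hrtop
  refine ⟨sub_pos.mp hlt, ?_⟩
  have := inv_anti₀ hr0 hr'
  rw [inv_inv] at this
  linarith

lemma measurableSet_shadeLeft (b : Pt) (t : ℝ) : MeasurableSet (shadeLeft b t) :=
  (measurableSet_lt measurable_fst measurable_const).inter
    (measurableSet_le measurable_const (measurable_incline measurable_id measurable_const))

lemma measurableSet_aboveLeft (b : Pt) (t : ℝ) : MeasurableSet (aboveLeft b t) :=
  (measurableSet_lt measurable_fst measurable_const).inter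
    (measurableSet_lt (measurable_incline measurable_id measurable_const) measurable_const)

/-- To the left of b, proximity increases with the base, so the record of the proximity encodes the
cut level. The record is 0 when nothing cuts the zone. -/
lemma record_proximity_le_iff {b : Pt} {t : ℝ} {y : ℕ → Pt} {p : Pt} (hp : p.1 < b.1) :
    record (proximity b) (aboveLeft b t) y ≤ proximity b p ↔
      cutLevel (Set.range y) b t ≤ (p.1 : EReal) := by
  rw [record_le_iff, cutLevel_le_iff, Set.forall_mem_range]
  refine forall_congr' fun n => forall_congr' fun hn => ?_
  rw [proximity_le_iff hp hn.1, EReal.coe_le_coe_iff]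

lemma shadeFrom_cutLevel (b : Pt) (t : ℝ) (y : ℕ → Pt) :
    shadeFrom b t (cutLevel (Set.range y) b t) =
      shadeLeft b t ∩ proximity b ⁻¹' Set.Ici (record (proximity b) (aboveLeft b t) y) := by
  ext p
  exact and_congr_right fun hp => (record_proximity_le_iff hp.1).symm

/-- The sequence `y` has distinct bases, which accumulate nowhere to the left of `α`. -/
def IsLocallyFiniteSeq (α : ℝ) (y : ℕ → Pt) : Prop :=
  (Function.Injective fun n => (y n).1) ∧ ∀ x, {n | x < (y n).1 ∧ (y n).1 < α}.Finite

lemma IsLocallyFiniteSeq.injective {α : ℝ} {y : ℕ → Pt} (h : IsLocallyFiniteSeq α y) :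
    Function.Injective y := fun _ _ hmn => h.1 (congrArg Prod.fst hmn)

lemma IsLocallyFiniteSeq.finite {α : ℝ} {y : ℕ → Pt} (h : IsLocallyFiniteSeq α y) (x : ℝ) :
    {r | r ∈ Set.range y ∧ x < r.1 ∧ r.1 < α}.Finite := by
  refine ((h.2 x).image y).subset ?_
  rintro _ ⟨⟨n, rfl⟩, hn⟩
  exact ⟨n, hn, rfl⟩

lemma IsLocallyFiniteSeq.finite_proximity {b : Pt} {y : ℕ → Pt} (h : IsLocallyFiniteSeq b.1 y)
    (r : ℝ≥0∞) (hr : 0 < r) : {n | r ≤ proximity b (y n)}.Finite := by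
  refine (h.2 (b.1 - r.toReal⁻¹ - 1)).subset fun n hn => ?_
  obtain ⟨h1, h2⟩ := le_of_le_proximity hr hn
  exact ⟨by linarith, h1⟩

section Intensity

variable (lam : ℝ) (law : Measure ℝ≥0) [IsProbabilityMeasure law]

lemma intensity_fst_preimage (s : Set ℝ) :
    intensity lam law (Prod.fst ⁻¹' s) = ENNReal.ofReal lam * volume s := by
  rw [intensity, ← Set.prod_univ, Measure.prod_prod]
  simp

lemma intensity_vertical (c : ℝ) : intensity lam law {p | p.1 = c} = 0 := by
  have := intensity_fst_preimage lam law {c}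
  rwa [Real.volume_singleton, mul_zero] at this

lemma intensity_singleton (p : Pt) : intensity lam law {p} = 0 :=
  measure_mono_null (by rintro _ rfl; rfl) (intensity_vertical lam law p.1)

lemma intensity_shadeLeft_proximity_ne_top (b : Pt) (t : ℝ) (r : ℝ≥0∞) (hr : 0 < r) :
    intensity lam law (shadeLeft b t ∩ proximity b ⁻¹' Set.Ici r) ≠ ⊤ := by
  have hsub : shadeLeft b t ∩ proximity b ⁻¹' Set.Ici r ⊆
      Prod.fst ⁻¹' (Set.Icc (b.1 - r.toReal⁻¹) b.1) := by
    rintro p ⟨-, hp⟩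
    obtain ⟨h1, h2⟩ := le_of_le_proximity hr hp
    exact ⟨h2, h1.le⟩
  refine ne_top_of_le_ne_top ?_ (measure_mono hsub)
  rw [intensity_fst_preimage, Real.volume_Icc]
  exact ENNReal.mul_ne_top ENNReal.ofReal_ne_top ENNReal.ofReal_ne_top

end Intensity

/-- The probabilities of the finite counts sum to 1 when the mean is finite. -/
lemma IsPoissonProcess.ae_finite_inter {Ω E : Type*} [MeasurableSpace Ω] [MeasurableSpace E]
    {P : Measure Ω} [IsProbabilityMeasure P] {Λ : Measure E} {Φ : Ω → Set E}
    (h : IsPoissonProcess P Λ Φ) {B : Set E} (hB : MeasurableSet B) (hΛ : Λ B ≠ ⊤) :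
    ∀ᵐ ω ∂P, (Φ ω ∩ B).Finite := by
  have hm := h.measurable_count B hB
  have h1 : ∀ n : ℕ, P {ω | (Φ ω ∩ B).encard = n} = ENNReal.ofReal (poissonProb (Λ B) n) := by
    intro n
    simpa using h.prob_count_fintype (ι := Unit) (fun _ => B) (fun _ => hB)
      (fun i j hij => absurd (Subsingleton.elim i j) hij) (fun _ => n)
  have h2 : P (⋃ n : ℕ, {ω | (Φ ω ∩ B).encard = n}) = 1 := by
    rw [measure_iUnion]
    · simp_rw [h1]
      exact tsum_poissonProb hΛ
    · intro m n hmn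
      refine Set.disjoint_left.mpr fun ω hω hω' => hmn ?_
      simp only [Set.mem_ofPred_eq] at hω hω'
      exact_mod_cast hω.symm.trans hω'
    · exact fun n => hm (measurableSet_singleton _)
  have h3 := (prob_compl_eq_zero_iff
    (MeasurableSet.iUnion fun n : ℕ => hm (measurableSet_singleton (n : ℕ∞)))).mpr h2
  filter_upwards [mem_ae_iff.mpr h3] with ω hω
  obtain ⟨n, hn⟩ := Set.mem_iUnion.mp hω
  exact Set.finite_of_encard_eq_coe hn

/-- A Poisson building process, as a random sequence of points. -/
theorem IsPoissonBuildingProcess.exists_seq {Ω : Type*} [MeasurableSpace Ω] {P : Measure Ω}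
    [IsProbabilityMeasure P] {lam : ℝ} {law : Measure ℝ≥0} [IsProbabilityMeasure law]
    {L : Ω → Set Pt} (hL : IsPoissonBuildingProcess P lam law L) (α : ℝ) :
    ∃ Y : ℕ → Ω → Pt, (∀ ω, L ω = Set.range fun n => Y n ω) ∧
      HasPoissonHits P (intensity lam law) Y ∧
      ∀ᵐ ω ∂P, IsLocallyFiniteSeq α fun n => Y n ω := by
  obtain ⟨X, H, hX, hH, hinj, hpois, hlaw, hiid, hind, hrange⟩ := hL
  refine ⟨fun n ω => (X n ω, H n ω), hrange, ⟨fun n => (hX n).prodMk (hH n), ?_⟩, ?_⟩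
  · intro k B n hB hd
    exact measure_forall_hits_eq hX hH hinj hpois hlaw hiid hind hB hd n
  · have hfin : ∀ N : ℕ, ∀ᵐ ω ∂P, ((Set.range fun n => X n ω) ∩ Set.Ioo (α - N) α).Finite := by
      intro N
      refine hpois.ae_finite_inter measurableSet_Ioo ?_
      rw [Measure.smul_apply, Real.volume_Ioo, smul_eq_mul]
      exact ENNReal.mul_ne_top ENNReal.ofReal_ne_top ENNReal.ofReal_ne_top
    filter_upwards [hinj, ae_all_iff.mpr hfin] with ω hω hfinω
    refine ⟨hω, fun x => ?_⟩
    obtain ⟨N, hN⟩ := exists_nat_ge (α - x)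
    refine ((hfinω N).preimage hω.injOn).subset fun n hn => ?_
    exact ⟨⟨n, rfl⟩, by have := hn.1; simp only at this; linarith, hn.2⟩

/-! ### Conditional law given the zone -/

section Conditional

variable {L' : Set Pt} {α : ℝ} {β : ℝ≥0} {q : Pt}

lemma mem_zone_splice_range_iff (hL' : IsLandscape L') (hb : (α, β) ∈ L')
    (hq : IsBlockingBuilding L' (α, β) q) {y : ℕ → Pt} (hy : IsLocallyFiniteSeq α y) (p : Pt) :
    p ∈ zone (splice L' (Set.range y) α) (α, β) ↔ p = (α, β) ∨
      (p ∈ shadeLeft (α, β) (incline (α, β) q) ∧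
        record (proximity (α, β)) (aboveLeft (α, β) (incline (α, β) q)) y
          ≤ proximity (α, β) p) := by
  rw [mem_zone_splice_iff hL' hb hq hy.finite]
  refine or_congr_right (and_congr_right fun hp => ?_)
  rw [record_proximity_le_iff hp.1]

/-- The events of the σ-algebra of the zone are, up to null sets, events of the record. -/
lemma exists_ae_eq_preimage_record {Ω : Type*} [MeasurableSpace Ω] {P : Measure Ω}
    (hL' : IsLandscape L') (hb : (α, β) ∈ L')
    (hq : IsBlockingBuilding L' (α, β) q) {Y : ℕ → Ω → Pt}
    (hgood : ∀ᵐ ω ∂P, IsLocallyFiniteSeq α fun n => Y n ω) {A : Set Ω}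
    (hA : MeasurableSet[sigmaOf fun ω =>
      zone (splice L' (Set.range fun n => Y n ω) α) (α, β)] A) :
    ∃ K, MeasurableSet K ∧ A =ᵐ[P] (fun ω => record (proximity (α, β))
      (aboveLeft (α, β) (incline (α, β) q)) (fun n => Y n ω)) ⁻¹' K := by
  set ρ : Ω → ℝ≥0∞ := fun ω => record (proximity (α, β))
      (aboveLeft (α, β) (incline (α, β) q)) (fun n => Y n ω) with hρ
  induction A, hA using MeasurableSpace.generateFrom_induction with
  | hC A hA _ =>
    obtain ⟨p, rfl⟩ := hA
    by_cases hpb : p = (α, β)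
    · refine ⟨Set.univ, MeasurableSet.univ, ?_⟩
      filter_upwards [hgood] with ω hω
      exact eq_iff_iff.mpr ⟨fun _ => trivial, fun _ =>
        (mem_zone_splice_range_iff hL' hb hq hω p).mpr (Or.inl hpb)⟩
    by_cases hp : p ∈ shadeLeft (α, β) (incline (α, β) q)
    · refine ⟨Set.Iic (proximity (α, β) p), measurableSet_Iic, ?_⟩
      filter_upwards [hgood] with ω hω
      refine eq_iff_iff.mpr ((mem_zone_splice_range_iff hL' hb hq hω p).trans ?_)
      exact ⟨fun h => (h.resolve_left hpb).2, fun h => Or.inr ⟨hp, h⟩⟩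
    · refine ⟨∅, MeasurableSet.empty, ?_⟩
      filter_upwards [hgood] with ω hω
      refine eq_iff_iff.mpr ((mem_zone_splice_range_iff hL' hb hq hω p).trans ?_)
      exact ⟨fun h => hp (h.resolve_left hpb).1, fun h => absurd h (Set.notMem_empty _)⟩
  | empty => exact ⟨∅, MeasurableSet.empty, by simp⟩
  | compl A _ ih =>
    obtain ⟨K, hK, hAK⟩ := ih
    exact ⟨Kᶜ, hK.compl, hAK.compl⟩
  | iUnion A _ ih =>
    choose K hK hAK using ih
    refine ⟨⋃ n, K n, MeasurableSet.iUnion hK, ?_⟩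
    rw [Set.preimage_iUnion]
    exact Filter.EventuallyEq.countable_iUnion hAK

/-- A version of the record that is measurable with respect to the zone. -/
def zoneLevel (b : Pt) (Z : Set Pt) : ℝ≥0∞ :=
  open Classical in
  ⨅ x : ℚ, if ((x : ℝ), (0 : ℝ≥0)) ∈ Z ∧ (x : ℝ) < b.1 then proximity b (x, 0) else ⊤

lemma measurable_zoneLevel {Ω : Type*} [MeasurableSpace Ω] (b : Pt) {Z : Ω → Set Pt}
    (hZ : ∀ p, MeasurableSet {ω | p ∈ Z ω}) : Measurable fun ω => zoneLevel b (Z ω) := by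
  classical
  unfold zoneLevel
  refine Measurable.iInf fun x => ?_
  have h : MeasurableSet {ω | ((x : ℝ), (0 : ℝ≥0)) ∈ Z ω ∧ (x : ℝ) < b.1} :=
    (hZ _).inter (MeasurableSet.const _)
  exact Measurable.ite h measurable_const measurable_const

/-- For t ≥ 0 the line of slope t rises towards b, so lowering a point and moving it right keeps it
in the shade. For t < 0 every ground point to the left of b is in the shade, as the line is above β
≥ 0 there. -/
lemma mem_shadeLeft_of_le {b p : Pt} {t : ℝ} (hp : p ∈ shadeLeft b t) {x : ℝ} (hpx : p.1 ≤ x)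
    (hx : x < b.1) : (x, (0 : ℝ≥0)) ∈ shadeLeft b t := by
  refine ⟨hx, ?_⟩
  have h := (le_incline_iff hp.1 t).mp hp.2
  rw [le_incline_iff hx]
  have h0 : (0 : ℝ) ≤ p.2 := p.2.2
  have hb0 : (0 : ℝ) ≤ b.2 := b.2.2
  simp only [NNReal.coe_zero, sub_zero]
  rcases le_or_gt 0 t with ht | ht
  · nlinarith [mul_le_mul_of_nonneg_left hpx ht]
  · nlinarith [mul_neg_of_neg_of_pos ht (sub_pos.mpr hx)]

/-- The level read off from rational ground points of the zone is at least the true one. Two shade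
points between the two levels cannot have different bases: a rational in between would be a ground
point of the zone and would lower the reading. So the discrepancy lies in one vertical line, which
is null. -/
lemma intensity_zoneLevel (lam : ℝ) (law : Measure ℝ≥0) [IsProbabilityMeasure law]
    (hL' : IsLandscape L') (hb : (α, β) ∈ L')
    (hq : IsBlockingBuilding L' (α, β) q) {y : ℕ → Pt} (hy : IsLocallyFiniteSeq α y) (B : Set Pt) :
    intensity lam law (B ∩ (shadeLeft (α, β) (incline (α, β) q) ∩ proximity (α, β) ⁻¹'
        Set.Ici (zoneLevel (α, β) (zone (splice L' (Set.range y) α) (α, β))))) =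
      intensity lam law (B ∩ (shadeLeft (α, β) (incline (α, β) q) ∩ proximity (α, β) ⁻¹'
        Set.Ici (record (proximity (α, β)) (aboveLeft (α, β) (incline (α, β) q)) y))) := by
  set ρ := record (proximity (α, β)) (aboveLeft (α, β) (incline (α, β) q)) y with hρ
  set ρ' := zoneLevel (α, β) (zone (splice L' (Set.range y) α) (α, β)) with hρ'
  set S := shadeLeft (α, β) (incline (α, β) q) with hS
  have hle : ρ ≤ ρ' := by
    refine le_iInf fun x => ?_
    split_ifs with h
    · rcases (mem_zone_splice_range_iff hL' hb hq hy _).mp h.1 with h' | h'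
      · exact absurd (congrArg Prod.fst h') h.2.ne
      · exact h'.2
    · exact le_top
  have hle' : ∀ x : ℚ, ((x : ℝ), (0 : ℝ≥0)) ∈ S → ρ ≤ proximity (α, β) (x, 0) →
      ρ' ≤ proximity (α, β) (x, 0) := by
    intro x hx hρx
    refine (iInf_le _ x).trans ?_
    rw [if_pos ⟨(mem_zone_splice_range_iff hL' hb hq hy _).mpr (Or.inr ⟨hx, hρx⟩), hx.1⟩]
  have hsubs : ∀ p p' : Pt, p ∈ S → p' ∈ S → ρ ≤ proximity (α, β) p →
      proximity (α, β) p' < ρ' → p'.1 ≤ p.1 := by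
    intro p p' hp hp' h1 h2
    by_contra! hlt
    obtain ⟨x, hx1, hx2⟩ := exists_rat_btwn hlt
    have hxα : (x : ℝ) < α := hx2.trans hp'.1
    have hxS := mem_shadeLeft_of_le hp hx1.le hxα
    have h3 := hle' x hxS (h1.trans ((proximity_le_iff hxα hp.1).mpr hx1.le))
    exact absurd (h3.trans ((proximity_le_iff hp'.1 hxα).mpr hx2.le)) (not_le.mpr h2)
  refine le_antisymm (measure_mono ?_) ?_
  · exact Set.inter_subset_inter_right _ (Set.inter_subset_inter_right _
      (Set.preimage_mono (Set.Ici_subset_Ici.mpr hle)))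
  · have hnull : intensity lam law {p | p ∈ S ∧ ρ ≤ proximity (α, β) p ∧
        proximity (α, β) p < ρ'} = 0 := by
      rcases Set.eq_empty_or_nonempty {p | p ∈ S ∧ ρ ≤ proximity (α, β) p ∧
        proximity (α, β) p < ρ'} with h | ⟨p, hp⟩
      · rw [h, measure_empty]
      · refine measure_mono_null (fun p' hp' => ?_) (intensity_vertical lam law p.1)
        exact le_antisymm (hsubs p p' hp.1 hp'.1 hp.2.1 hp'.2.2)
          (hsubs p' p hp'.1 hp.1 hp'.2.1 hp.2.2)
    refine measure_mono_ae ?_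
    have hae : ∀ᵐ p ∂(intensity lam law), ¬ (p ∈ S ∧ ρ ≤ proximity (α, β) p ∧
        proximity (α, β) p < ρ') := by
      rw [ae_iff]
      simpa only [not_not] using hnull
    filter_upwards [hae] with p hp hpmem
    exact ⟨hpmem.1, hpmem.2.1, not_lt.mp fun h => hp ⟨hpmem.2.1, hpmem.2.2, h⟩⟩

lemma encard_relayedBuildings_inter (hL' : IsLandscape L') (hb : (α, β) ∈ L')
    (hq : IsBlockingBuilding L' (α, β) q) {y : ℕ → Pt} (hy : IsLocallyFiniteSeq α y) (B : Set Pt) :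
    (relayedBuildings (splice L' (Set.range y) α) (α, β) ∩ B).encard =
      hits y (B ∩ (shadeLeft (α, β) (incline (α, β) q) ∩ proximity (α, β) ⁻¹'
        Set.Ici (record (proximity (α, β)) (aboveLeft (α, β) (incline (α, β) q)) y))) := by
  rw [relayedBuildings_splice_eq hL' hb hq hy.finite, shadeFrom_cutLevel,
    hits_eq_encard_range_inter hy.injective, Set.inter_assoc, Set.inter_comm B]

lemma intensity_inter_zone (lam : ℝ) (law : Measure ℝ≥0) [IsProbabilityMeasure law]
    (hL' : IsLandscape L') (hb : (α, β) ∈ L')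
    (hq : IsBlockingBuilding L' (α, β) q) {y : ℕ → Pt} (hy : IsLocallyFiniteSeq α y) (B : Set Pt) :
    intensity lam law (B ∩ zone (splice L' (Set.range y) α) (α, β)) =
      intensity lam law (B ∩ (shadeLeft (α, β) (incline (α, β) q) ∩ proximity (α, β) ⁻¹'
        Set.Ici (record (proximity (α, β)) (aboveLeft (α, β) (incline (α, β) q)) y))) := by
  rw [zone_splice_eq hL' hb hq hy.finite, shadeFrom_cutLevel]
  refine le_antisymm ?_ (measure_mono (Set.inter_subset_inter_right _ (Set.subset_insert _ _)))
  rw [Set.insert_eq, Set.inter_union_distrib_left]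
  refine (measure_union_le _ _).trans ?_
  rw [measure_mono_null Set.inter_subset_right (intensity_singleton lam law (α, β)), zero_add]

lemma aestronglyMeasurable_countWeight_record {Ω : Type*} [MeasurableSpace Ω] {P : Measure Ω}
    (lam : ℝ) (law : Measure ℝ≥0) [IsProbabilityMeasure law]
    (hL' : IsLandscape L') (hb : (α, β) ∈ L')
    (hq : IsBlockingBuilding L' (α, β) q) {Y : ℕ → Ω → Pt}
    (hgood : ∀ᵐ ω ∂P, IsLocallyFiniteSeq α fun n => Y n ω) {k : ℕ} (B : Fin k → Set Pt)
    (n : Fin k → ℕ) :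
    AEStronglyMeasurable[sigmaOf fun ω => zone (splice L' (Set.range fun n => Y n ω) α) (α, β)]
      (fun ω => countWeight (intensity lam law) (proximity (α, β))
        (shadeLeft (α, β) (incline (α, β) q)) B n
        (record (proximity (α, β)) (aboveLeft (α, β) (incline (α, β) q)) fun n => Y n ω)) P := by
  have hmeas := (measurable_countWeight (intensity lam law) (proximity (α, β))
    (shadeLeft (α, β) (incline (α, β) q)) B n).comp
    (@measurable_zoneLevel _
      (sigmaOf fun ω => zone (splice L' (Set.range fun n => Y n ω) α) (α, β)) (α, β)
      (fun ω => zone (splice L' (Set.range fun n => Y n ω) α) (α, β))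
      fun p => MeasurableSpace.measurableSet_generateFrom ⟨p, rfl⟩)
  refine ⟨_, hmeas.stronglyMeasurable, ?_⟩
  filter_upwards [hgood] with ω hω
  rw [Function.comp_apply, countWeight, countWeight]
  simp_rw [intensity_zoneLevel lam law hL' hb hq hω]

lemma sigmaOf_zone_le {Ω : Type*} [mΩ : MeasurableSpace Ω] (hL' : IsLandscape L')
    {Y : ℕ → Ω → Pt} (hY : ∀ n, Measurable (Y n)) (b : Pt) :
    (sigmaOf fun ω => zone (splice L' (Set.range fun n => Y n ω) α) b) ≤ mΩ := by
  refine MeasurableSpace.generateFrom_le ?_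
  rintro _ ⟨p, rfl⟩
  exact measurableSet_mem_zone_splice hY hL' α b measurable_const

/-- The conditional law of the relayed buildings given the zone. -/
theorem isCondPoissonProcess_relayedBuildings {Ω : Type*} [MeasurableSpace Ω] {P : Measure Ω}
    [IsProbabilityMeasure P] {lam : ℝ} {law : Measure ℝ≥0} [IsProbabilityMeasure law]
    (hL' : IsLandscape L') (hb : (α, β) ∈ L')
    (hq : IsBlockingBuilding L' (α, β) q) {Y : ℕ → Ω → Pt}
    (hY : HasPoissonHits P (intensity lam law) Y)
    (hgood : ∀ᵐ ω ∂P, IsLocallyFiniteSeq α fun n => Y n ω) :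
    IsCondPoissonProcess P
      (sigmaOf fun ω => zone (splice L' (Set.range fun n => Y n ω) α) (α, β))
      (fun ω => (intensity lam law).restrict
        (zone (splice L' (Set.range fun n => Y n ω) α) (α, β)))
      (fun ω => relayedBuildings (splice L' (Set.range fun n => Y n ω) α) (α, β)) := by
  have hκ := measurable_proximity (α, β)
  have hS := measurableSet_shadeLeft (α, β) (incline (α, β) q)
  have hT := measurableSet_aboveLeft (α, β) (incline (α, β) q)
  have hρ := measurable_record hY.measurable hκ hT
  -- As elaborated, the field `le` compares the σ-algebra with itself. The inclusion in the ambient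
  -- σ-algebra is `sigmaOf_zone_le`, which is supplied to the conditional expectation below.
  refine ⟨le_rfl, ?_, ?_⟩
  · intro B hB
    refine ⟨_, measurable_encard_setOf
        (A := fun m => Y m ⁻¹' B ∩ (Y m ⁻¹' (shadeLeft (α, β) (incline (α, β) q)) ∩
          {ω | record (proximity (α, β)) (aboveLeft (α, β) (incline (α, β) q)) (fun n => Y n ω)
            ≤ proximity (α, β) (Y m ω)})) fun m =>
          (hY.measurable m hB).inter ((hY.measurable m hS).inter
            (measurableSet_le hρ (hκ.comp (hY.measurable m)))), ?_⟩
    filter_upwards [hgood] with ω hω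
    exact encard_relayedBuildings_inter hL' hb hq hω B
  · intro k B n hB hd
    have key := hY.condExp_countEvent_record hκ hS hT (disjoint_shadeLeft_aboveLeft _ _)
      (intensity_shadeLeft_proximity_ne_top lam law _ _)
      (hgood.mono fun ω hω => IsLocallyFiniteSeq.finite_proximity (b := (α, β)) hω)
      (sigmaOf_zone_le hL' hY.measurable _)
      (fun A hA => exists_ae_eq_preimage_record hL' hb hq hgood hA) hB hd n
      (aestronglyMeasurable_countWeight_record lam law hL' hb hq hgood B n)
    refine (condExp_congr_ae ?_).trans (key.trans ?_)
    · refine indicator_ae_eq_of_ae_eq_set (Filter.eventuallyEq_set.mpr ?_)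
      filter_upwards [hgood] with ω hω
      simp only [countEvent, Set.mem_ofPred_eq, encard_relayedBuildings_inter hL' hb hq hω]
    · filter_upwards [hgood] with ω hω
      rw [countWeight]
      refine Finset.prod_congr rfl fun i _ => ?_
      rw [Measure.restrict_apply (hB i), intensity_inter_zone lam law hL' hb hq hω]

end Conditional

/-! ### Means of mixed Poisson counts -/

lemma toENNReal_eq_tsum_add (m : ℕ∞) :
    (m : ℝ≥0∞) = ∑' n : ℕ, (n : ℝ≥0∞) * (if m = n then 1 else 0) + ⊤ * (if m = ⊤ then 1 else 0) := by
  induction m using ENat.recTopCoe with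
  | top => simp
  | coe k =>
    rw [tsum_eq_single k]
    · simp
    · intro n hn
      have : (k : ℕ∞) ≠ n := by exact_mod_cast hn.symm
      simp [this]

/-- A mixed Poisson variable has the mean of its random parameter. -/
lemma lintegral_toENNReal_eq_of_mixed_poisson {Ω : Type*} [MeasurableSpace Ω] {P : Measure Ω}
    [IsProbabilityMeasure P] {M : Ω → ℕ∞} (hM : Measurable M) {R : Ω → ℝ≥0∞} (hR : Measurable R)
    (h : ∀ n : ℕ, P {ω | M ω = n} = ∫⁻ ω, ENNReal.ofReal (poissonProb (R ω) n) ∂P) :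
    ∫⁻ ω, (M ω : ℝ≥0∞) ∂P = ∫⁻ ω, R ω ∂P := by
  have hpp : ∀ n, Measurable fun ω => ENNReal.ofReal (poissonProb (R ω) n) := fun n =>
    ((measurable_poissonProb n).comp hR).ennreal_ofReal
  have hind : ∀ m : ℕ∞, Measurable fun ω => if M ω = m then (1 : ℝ≥0∞) else 0 := fun m =>
    Measurable.ite (hM (measurableSet_singleton m)) measurable_const measurable_const
  have hindR : Measurable fun ω => if R ω = ⊤ then (1 : ℝ≥0∞) else 0 :=
    Measurable.ite (hR (measurableSet_singleton ⊤)) measurable_const measurable_const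
  have hsplit : ∀ ω, R ω = ∑' n : ℕ, (n : ℝ≥0∞) * ENNReal.ofReal (poissonProb (R ω) n)
      + ⊤ * (if R ω = ⊤ then 1 else 0) := by
    intro ω
    by_cases hω : R ω = ⊤
    · simp [hω]
    · rw [tsum_poissonProb_mul_nat hω]
      simp [hω]
  have hM1 : ∀ m : ℕ∞, ∫⁻ ω, (if M ω = m then (1 : ℝ≥0∞) else 0) ∂P = P {ω | M ω = m} := by
    intro m
    have hm : MeasurableSet {ω | M ω = m} := hM (measurableSet_singleton m)
    rw [← lintegral_indicator_one hm]
    exact lintegral_congr fun ω => by simp [Set.indicator]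
  have htotM : ∑' n : ℕ, P {ω | M ω = n} + P {ω | M ω = ⊤} = 1 := by
    have e : ∀ ω, (1 : ℝ≥0∞) = ∑' n : ℕ, (if M ω = n then 1 else 0)
        + (if M ω = ⊤ then 1 else 0) := by
      intro ω
      induction M ω using ENat.recTopCoe with
      | top => simp
      | coe k =>
        rw [tsum_eq_single k]
        · simp
        · intro n hn
          have : (k : ℕ∞) ≠ n := by exact_mod_cast hn.symm
          simp [this]
    simp_rw [← hM1]
    rw [← lintegral_tsum fun n : ℕ => (hind n).aemeasurable,
      ← lintegral_add_right _ (hind ⊤)]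
    exact (lintegral_congr fun ω => (e ω).symm).trans (by simp)
  have htotR : ∑' n : ℕ, P {ω | M ω = n} + ∫⁻ ω, (if R ω = ⊤ then (1 : ℝ≥0∞) else 0) ∂P = 1 := by
    have e : ∀ ω, (1 : ℝ≥0∞) = ∑' n : ℕ, ENNReal.ofReal (poissonProb (R ω) n)
        + (if R ω = ⊤ then 1 else 0) := by
      intro ω
      by_cases hω : R ω = ⊤
      · simp [hω]
      · rw [tsum_poissonProb hω]
        simp [hω]
    simp_rw [h]
    rw [← lintegral_tsum fun n : ℕ => (hpp n).aemeasurable,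
      ← lintegral_add_right _ hindR]
    exact (lintegral_congr fun ω => (e ω).symm).trans (by simp)
  -- On both sides the mass at infinity is what the finite values leave, so an infinite count and an
  -- infinite parameter have the same probability.
  have htop : P {ω | M ω = ⊤} = ∫⁻ ω, (if R ω = ⊤ then (1 : ℝ≥0∞) else 0) ∂P := by
    have hne : ∑' n : ℕ, P {ω | M ω = n} ≠ ⊤ :=
      ne_top_of_le_ne_top ENNReal.one_ne_top (le_self_add.trans htotM.le)
    exact (ENNReal.add_right_inj hne).mp (htotM.trans htotR.symm)
  calc ∫⁻ ω, (M ω : ℝ≥0∞) ∂P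
      = ∑' n : ℕ, (n : ℝ≥0∞) * P {ω | M ω = n} + ⊤ * P {ω | M ω = ⊤} := by
        simp_rw [toENNReal_eq_tsum_add]
        rw [lintegral_add_right _ ((hind ⊤).const_mul _),
          lintegral_tsum fun n : ℕ => ((hind n).const_mul _).aemeasurable,
          lintegral_const_mul _ (hind ⊤), hM1]
        congr 2
        ext n
        rw [lintegral_const_mul _ (hind n), hM1]
    _ = ∑' n : ℕ, (n : ℝ≥0∞) * ∫⁻ ω, ENNReal.ofReal (poissonProb (R ω) n) ∂P
          + ⊤ * ∫⁻ ω, (if R ω = ⊤ then (1 : ℝ≥0∞) else 0) ∂P := by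
        simp_rw [h, htop]
    _ = ∫⁻ ω, R ω ∂P := by
        rw [lintegral_congr hsplit, lintegral_add_right _ (hindR.const_mul _),
          lintegral_tsum fun n : ℕ => ((hpp n).const_mul _).aemeasurable,
          lintegral_const_mul _ hindR]
        congr 2
        ext n
        rw [lintegral_const_mul _ (hpp n)]

section

variable {Ω E : Type*} [MeasurableSpace Ω] [MeasurableSpace E] {P : Measure Ω}
  {Λ : Measure E} {Y : ℕ → Ω → E} {κ : E → ℝ≥0∞} {S T : Set E}

/-- The expected number of points of `S` beyond the record of `T`. -/
lemma HasPoissonHits.lintegral_hits_record [IsProbabilityMeasure P]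
    (h : HasPoissonHits P Λ Y) (hκ : Measurable κ)
    (hS : MeasurableSet S) (hT : MeasurableSet T) (hST : Disjoint S T)
    (hΛ : ∀ r, 0 < r → Λ (S ∩ κ ⁻¹' Set.Ici r) ≠ ⊤)
    (hfin : ∀ᵐ ω ∂P, ∀ r, 0 < r → {n | r ≤ κ (Y n ω)}.Finite) :
    ∫⁻ ω, (hits (fun n => Y n ω)
        (Set.univ ∩ (S ∩ κ ⁻¹' Set.Ici (record κ T fun n => Y n ω))) : ℝ≥0∞) ∂P =
      ∫⁻ ω, Λ (S ∩ κ ⁻¹' Set.Ici (record κ T fun n => Y n ω)) ∂P := by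
  have hρ := measurable_record h.measurable hκ hT
  refine lintegral_toENNReal_eq_of_mixed_poisson ?_ ?_ ?_
  · exact measurable_encard_setOf
      (A := fun m => Set.univ ∩ (Y m ⁻¹' S ∩
        {ω | record κ T (fun n => Y n ω) ≤ κ (Y m ω)})) fun m =>
        MeasurableSet.univ.inter ((h.measurable m hS).inter
          (measurableSet_le hρ (hκ.comp (h.measurable m))))
  · have : Antitone fun r => Λ (S ∩ κ ⁻¹' Set.Ici r) := fun r s hrs =>
      measure_mono (Set.inter_subset_inter_right _
        (Set.preimage_mono (Set.Ici_subset_Ici.mpr hrs)))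
    exact this.measurable.comp hρ
  · intro n
    have hE := measurableSet_countEvent_comp h.measurable hκ hS (k := 1)
      (fun _ => MeasurableSet.univ) (fun _ => n) hρ
    have := h.lintegral_countEvent_comp hκ hS hΛ hfin (k := 1) (B := fun _ => Set.univ)
      (fun _ => MeasurableSet.univ) (fun i j hij => absurd (Subsingleton.elim i j) hij)
      (fun _ => n) hρ
      (fun r K hK => h.measure_countEvent_inter hκ hS hT hST (fun _ => MeasurableSet.univ)
        (fun i j hij => absurd (Subsingleton.elim i j) hij) _ r hK) MeasurableSet.univ
    rw [Set.preimage_univ, Measure.restrict_univ, lintegral_indicator_one hE] at this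
    simpa [countEvent, countWeight] using this

lemma measurable_measure_le {ρ : Ω → ℝ≥0∞} : Measurable fun r => P {ω | ρ ω ≤ r} :=
  Monotone.measurable fun _ _ hrs => measure_mono fun _ hω => le_trans hω hrs

/-- Fubini for the pairs (ω, e) with ρ ω ≤ κ e. It serves twice: with the intensity for the number
of buildings, and with Lebesgue measure on the ground for the ground length. -/
lemma lintegral_measure_inter_Ici [SFinite P] [SFinite Λ] {ρ : Ω → ℝ≥0∞} (hρ : Measurable ρ)
    (hκ : Measurable κ) :
    ∫⁻ ω, Λ (S ∩ κ ⁻¹' Set.Ici (ρ ω)) ∂P = ∫⁻ e in S, P {ω | ρ ω ≤ κ e} ∂Λ := by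
  have hm : MeasurableSet {p : Ω × E | ρ p.1 ≤ κ p.2} :=
    measurableSet_le (hρ.comp measurable_fst) (hκ.comp measurable_snd)
  have h1 : ∀ ω, Λ (S ∩ κ ⁻¹' Set.Ici (ρ ω))
      = ∫⁻ e in S, {p : Ω × E | ρ p.1 ≤ κ p.2}.indicator 1 (ω, e) ∂Λ := by
    intro ω
    have hm' : MeasurableSet (κ ⁻¹' Set.Ici (ρ ω)) := hκ measurableSet_Ici
    rw [Set.inter_comm, ← Measure.restrict_apply hm', ← lintegral_indicator_one hm']
    rfl
  have h2 : ∀ e, P {ω | ρ ω ≤ κ e}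
      = ∫⁻ ω, {p : Ω × E | ρ p.1 ≤ κ p.2}.indicator 1 (ω, e) ∂P := by
    intro e
    have hm' : MeasurableSet {ω | ρ ω ≤ κ e} := measurableSet_le hρ measurable_const
    rw [← lintegral_indicator_one hm']
    rfl
  simp_rw [h1, h2]
  exact lintegral_lintegral_swap (measurable_one.indicator hm).aemeasurable

end

/-! ### Vertical sections of the shade and of its complement -/

/-- The probability that a building with base `x` is in `aboveLeft b t`, for `x` to the left of
`b`. -/
def tailAlong (law : Measure ℝ≥0) (b : Pt) (t x : ℝ) : ℝ :=
  law.real {h : ℝ≥0 | (b.2 : ℝ) - t * (b.1 - x) < h}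

section Sections

variable {law : Measure ℝ≥0} {b : Pt} {t : ℝ}

lemma tailAlong_nonneg (x : ℝ) : 0 ≤ tailAlong law b t x := measureReal_nonneg

variable [IsProbabilityMeasure law]

lemma tailAlong_le_one (x : ℝ) : tailAlong law b t x ≤ 1 := measureReal_le_one

lemma antitone_tailAlong (ht : 0 ≤ t) : Antitone (tailAlong law b t) := by
  intro x y hxy
  refine measureReal_mono fun h hh => ?_
  have : t * (b.1 - y) ≤ t * (b.1 - x) := by gcongr
  exact lt_of_le_of_lt (by linarith) (show (b.2 : ℝ) - t * (b.1 - y) < h from hh)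

lemma measurable_tailAlong : Measurable (tailAlong law b t) := by
  have hm : MeasurableSet {p : ℝ × ℝ≥0 | (b.2 : ℝ) - t * (b.1 - p.1) < p.2} :=
    measurableSet_lt (by fun_prop) (by fun_prop)
  exact (measurable_measure_prodMk_left hm).ennreal_toReal

lemma mem_shadeLeft_iff {p : Pt} (hp : p.1 < b.1) :
    p ∈ shadeLeft b t ↔ (p.2 : ℝ) ≤ b.2 - t * (b.1 - p.1) := by
  rw [shadeLeft, Set.mem_ofPred_eq, le_incline_iff hp]
  constructor
  · rintro ⟨-, h⟩
    linarith
  · exact fun h => ⟨hp, by linarith⟩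

lemma mem_aboveLeft_iff {p : Pt} (hp : p.1 < b.1) :
    p ∈ aboveLeft b t ↔ (b.2 : ℝ) - t * (b.1 - p.1) < p.2 := by
  rw [← not_iff_not, not_mem_aboveLeft_iff hp, mem_shadeLeft_iff hp, not_lt]

/-- The abscissas of the points of `shadeLeft b t`. -/
def shadeBases (b : Pt) (t : ℝ) : Set ℝ := {x | (x, (0 : ℝ≥0)) ∈ shadeLeft b t}

lemma mem_shadeBases_iff {x : ℝ} : x ∈ shadeBases b t ↔ x < b.1 ∧ t * (b.1 - x) ≤ b.2 := by
  constructor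
  · intro h
    have h' := (mem_shadeLeft_iff h.1).mp h
    simp only [NNReal.coe_zero] at h'
    exact ⟨h.1, by linarith⟩
  · rintro ⟨h1, h2⟩
    refine (mem_shadeLeft_iff (p := (x, 0)) h1).mpr ?_
    simp only [NNReal.coe_zero]
    linarith

lemma measurableSet_shadeBases : MeasurableSet (shadeBases b t) :=
  measurable_prodMk_right (measurableSet_shadeLeft b t)

lemma measure_section_shadeLeft (x : ℝ) :
    law {h | (x, h) ∈ shadeLeft b t}
      = (shadeBases b t).indicator (fun x => ENNReal.ofReal (1 - tailAlong law b t x)) x := by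
  by_cases hx : x ∈ shadeBases b t
  · rw [Set.indicator_of_mem hx]
    have hxb : x < b.1 := hx.1
    have hm : MeasurableSet {h : ℝ≥0 | (b.2 : ℝ) - t * (b.1 - x) < h} :=
      measurableSet_lt measurable_const (by fun_prop)
    rw [tailAlong, ← probReal_compl_eq_one_sub hm, ofReal_measureReal]
    congr 1
    ext h
    simp [mem_shadeLeft_iff (p := (x, h)) hxb]
  · rw [Set.indicator_of_notMem hx]
    convert measure_empty (μ := law)
    ext h
    simp only [Set.mem_ofPred_eq, Set.mem_empty_iff_false, iff_false]
    exact fun hh => hx (mem_shadeLeft_of_le hh le_rfl hh.1)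

/-- The fibre of the shade over a base x has mass 1 - w(x), where w is `tailAlong`; this factor is
what separates the mean number of buildings from λ times the mean ground length. -/
lemma setLIntegral_shadeLeft (lam : ℝ) {Ψ : ℝ → ℝ≥0∞} (hΨ : Measurable Ψ) :
    ∫⁻ p in shadeLeft b t, Ψ p.1 ∂(intensity lam law) = ENNReal.ofReal lam *
      ∫⁻ x in shadeBases b t, ENNReal.ofReal (1 - tailAlong law b t x) * Ψ x := by
  have hS := measurableSet_shadeLeft b t
  rw [← lintegral_indicator hS, intensity,
    lintegral_prod ((shadeLeft b t).indicator fun p => Ψ p.1)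
      ((hΨ.comp measurable_fst).indicator hS).aemeasurable,
    lintegral_smul_measure, smul_eq_mul, ← lintegral_indicator measurableSet_shadeBases]
  congr 2
  ext x
  have hm : MeasurableSet {h | (x, h) ∈ shadeLeft b t} := measurable_prodMk_left hS
  calc ∫⁻ h, (shadeLeft b t).indicator (fun p => Ψ p.1) (x, h) ∂law
      = ∫⁻ h, {h | (x, h) ∈ shadeLeft b t}.indicator (fun _ => Ψ x) h ∂law := rfl
    _ = Ψ x * law {h | (x, h) ∈ shadeLeft b t} := lintegral_indicator_const hm _
    _ = _ := by
      rw [measure_section_shadeLeft]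
      by_cases hx : x ∈ shadeBases b t
      · simp [hx, mul_comm]
      · simp [hx]

/-- Mean number of cutting buildings strictly between x and b; its `expNeg` is the probability that
the cut level is at most x. -/
lemma intensity_aboveLeft_Ioi (lam : ℝ) {x : ℝ} (hx : x < b.1) :
    intensity lam law (aboveLeft b t ∩ proximity b ⁻¹' Set.Ioi (proximity b (x, 0))) =
      ENNReal.ofReal lam * ∫⁻ y in Set.Ioo x b.1, ENNReal.ofReal (tailAlong law b t y) := by
  have hm : MeasurableSet (aboveLeft b t ∩ proximity b ⁻¹' Set.Ioi (proximity b (x, 0))) :=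
    (measurableSet_aboveLeft b t).inter (measurable_proximity b measurableSet_Ioi)
  rw [intensity, Measure.prod_apply hm, lintegral_smul_measure, smul_eq_mul,
    ← lintegral_indicator measurableSet_Ioo]
  congr 2
  ext y
  by_cases hy : y ∈ Set.Ioo x b.1
  · rw [Set.indicator_of_mem hy, tailAlong, ofReal_measureReal]
    congr 1
    ext h
    have h1 : proximity b (x, 0) < proximity b (y, h) := by
      rw [← not_le, proximity_le_iff (p := (x, 0)) hx (r := (y, h)) hy.2, not_le]
      exact hy.1
    simp [mem_aboveLeft_iff (p := (y, h)) hy.2, h1]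
  · rw [Set.indicator_of_notMem hy]
    convert measure_empty (μ := law)
    ext h
    simp only [Set.mem_preimage, Set.mem_inter_iff, Set.mem_Ioi, Set.mem_empty_iff_false,
      iff_false, not_and, not_lt]
    intro hy'
    have hyb : y < b.1 := hy'.1
    rw [proximity_le_iff (p := (x, 0)) hx (r := (y, h)) hyb]
    exact not_lt.mp fun h => hy ⟨h, hyb⟩

end Sections

/-! ### Integrating the density of the cut -/

/-- The integral of the density of the first point of an inhomogeneous Poisson process. -/
lemma integral_mul_exp_neg_integral {w : ℝ → ℝ} (hw : Antitone w) (lam c α : ℝ) :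
    ∫ x in c..α, lam * w x * Real.exp (-(lam * ∫ y in x..α, w y))
      = 1 - Real.exp (-(lam * ∫ y in c..α, w y)) := by
  have hint : ∀ a b : ℝ, IntervalIntegrable w volume a b := fun a b => hw.intervalIntegrable
  have hG : ∀ x, ∫ y in x..α, w y = -∫ y in α..x, w y := fun x =>
    intervalIntegral.integral_symm _ _
  have hGc : Continuous fun x => ∫ y in x..α, w y := by
    simp_rw [hG]
    exact (intervalIntegral.continuous_primitive hint α).neg
  have hEc : Continuous fun x => Real.exp (-(lam * ∫ y in x..α, w y)) :=
    Real.continuous_exp.comp (continuous_const.mul hGc).neg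
  -- The exponential is a primitive except at the discontinuities of the monotone function w, which
  -- are countably many.
  rw [integral_eq_of_hasDerivAt_off_countable
    (fun x => Real.exp (-(lam * ∫ y in x..α, w y))) _ hw.countable_not_continuousAt
    hEc.continuousOn ?_ ?_]
  · simp
  · rintro x ⟨-, hx⟩
    have hxc : ContinuousAt w x := not_not.mp hx
    have h1 : HasDerivAt (fun x => ∫ y in α..x, w y) (w x) x :=
      intervalIntegral.integral_hasDerivAt_right (hint α x)
        (hw.measurable.stronglyMeasurable.stronglyMeasurableAtFilter) hxc
    have h2 : HasDerivAt (fun x => -(lam * ∫ y in x..α, w y)) (lam * w x) x := by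
      simp_rw [hG]
      exact ((h1.neg.const_mul lam).neg).congr_deriv (by ring)
    exact h2.exp.congr_deriv (by ring)
  · exact ((hint c α).const_mul lam).mul_continuousOn hEc.continuousOn

lemma expNeg_ofReal {r : ℝ} (hr : 0 ≤ r) :
    expNeg (ENNReal.ofReal r) = ENNReal.ofReal (Real.exp (-r)) := by
  rw [expNeg_eq_ofReal ENNReal.ofReal_ne_top, ENNReal.toReal_ofReal hr]

/-- The same integral in `[0, ∞]`. -/
lemma lintegral_mul_expNeg_lintegral {w : ℝ → ℝ} (hw : Antitone w) (hw0 : ∀ x, 0 ≤ w x) {lam : ℝ}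
    (hlam : 0 ≤ lam) {c α : ℝ} (hc : c ≤ α) :
    ENNReal.ofReal lam * ∫⁻ x in Set.Ico c α, ENNReal.ofReal (w x) *
        expNeg (ENNReal.ofReal lam * ∫⁻ y in Set.Ioo x α, ENNReal.ofReal (w y))
      = ENNReal.ofReal (1 - Real.exp (-(lam * ∫ y in c..α, w y))) := by
  have hint : ∀ a b : ℝ, IntervalIntegrable w volume a b := fun a b => hw.intervalIntegrable
  have hinner : ∀ x ≤ α, ENNReal.ofReal lam * ∫⁻ y in Set.Ioo x α, ENNReal.ofReal (w y)
      = ENNReal.ofReal (lam * ∫ y in x..α, w y) := by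
    intro x hx
    rw [ENNReal.ofReal_mul hlam, intervalIntegral.integral_of_le hx, integral_Ioc_eq_integral_Ioo,
      ofReal_integral_eq_lintegral_ofReal]
    · exact ((hint x α).1).mono_set Set.Ioo_subset_Ioc_self
    · exact Eventually.of_forall hw0
  have hnonneg : ∀ x ≤ α, 0 ≤ lam * ∫ y in x..α, w y := fun x hx =>
    mul_nonneg hlam (intervalIntegral.integral_nonneg hx fun y _ => hw0 y)
  have hGc : Continuous fun x => ∫ y in x..α, w y := by
    simp_rw [fun x => intervalIntegral.integral_symm (f := w) (μ := volume) α x]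
    exact (intervalIntegral.continuous_primitive hint α).neg
  have hEc : Continuous fun x => Real.exp (-(lam * ∫ y in x..α, w y)) :=
    Real.continuous_exp.comp (continuous_const.mul hGc).neg
  rw [← integral_mul_exp_neg_integral hw, intervalIntegral.integral_of_le hc,
    ← integral_Ico_eq_integral_Ioc, ofReal_integral_eq_lintegral_ofReal]
  · rw [← lintegral_const_mul' _ _ ENNReal.ofReal_ne_top]
    refine setLIntegral_congr_fun measurableSet_Ico fun x hx => ?_
    rw [hinner x hx.2.le, expNeg_ofReal (hnonneg x hx.2.le), ← mul_assoc,
      ← ENNReal.ofReal_mul hlam, ← ENNReal.ofReal_mul (mul_nonneg hlam (hw0 x))]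
  · have h := ((hint c α).const_mul lam).mul_continuousOn (hEc.continuousOn)
    exact IntegrableOn.congr_set_ae h.1 Ico_ae_eq_Ioc
  · exact Eventually.of_forall fun x => mul_nonneg (mul_nonneg hlam (hw0 x)) (Real.exp_pos _).le

/-! ### Ground length and mean number of relayed buildings -/

section GroundLength

variable {L' : Set Pt} {α : ℝ} {β : ℝ≥0} {q : Pt}

lemma shadeBases_of_eq_zero {b : Pt} {t : ℝ} (ht : t = 0) : shadeBases b t = Set.Iio b.1 := by
  ext x
  simp [mem_shadeBases_iff, ht]

lemma shadeBases_of_pos {b : Pt} {t : ℝ} (ht : 0 < t) :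
    shadeBases b t = Set.Ico (b.1 - b.2 / t) b.1 := by
  ext x
  rw [mem_shadeBases_iff, Set.mem_Ico, and_comm, sub_le_comm, le_div_iff₀ ht, mul_comm]

lemma shadeBases_inter_proximity (b : Pt) (t : ℝ) (y : ℕ → Pt) :
    shadeBases b t ∩ (fun x : ℝ => proximity b (x, 0)) ⁻¹'
        Set.Ici (record (proximity b) (aboveLeft b t) y) =
      {x | x ∈ shadeBases b t ∧ cutLevel (Set.range y) b t ≤ (x : EReal)} := by
  ext x
  refine and_congr_right fun hx => ?_
  exact record_proximity_le_iff (p := (x, 0)) hx.1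

/-- The trace on the ground is an interval ending at b.1 and starting at the larger of c and the
foot of the shade, so its length is the smaller of two distances. For t = 0 there is no foot. -/
lemma volume_shadeBases_inter {b : Pt} {t : ℝ} (ht : 0 ≤ t) (c : EReal) :
    volume {x : ℝ | x ∈ shadeBases b t ∧ c ≤ (x : EReal)} =
      min ((b.1 : EReal) - c).toENNReal (if t = 0 then ⊤ else ENNReal.ofReal ((b.2 : ℝ) / t)) := by
  induction c using EReal.rec with
  | bot =>
    simp only [bot_le, and_true, Set.ofPred_mem_eq]
    split_ifs with h0
    · simp [shadeBases_of_eq_zero h0]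
    · rw [shadeBases_of_pos (lt_of_le_of_ne ht (Ne.symm h0)), Real.volume_Ico]
      simp
  | top => simp
  | coe c =>
    have hE : ((b.1 : EReal) - (c : EReal)).toENNReal = ENNReal.ofReal (b.1 - c) := by
      rw [← EReal.coe_sub]
      rfl
    simp only [EReal.coe_le_coe_iff, hE]
    split_ifs with h0
    · have : {x : ℝ | x ∈ shadeBases b t ∧ c ≤ x} = Set.Ico c b.1 := by
        ext x
        simp [shadeBases_of_eq_zero h0, and_comm]
      rw [this, Real.volume_Ico, min_eq_left le_top]
    · have : {x : ℝ | x ∈ shadeBases b t ∧ c ≤ x} = Set.Ico (max c (b.1 - b.2 / t)) b.1 := by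
        ext x
        simp only [shadeBases_of_pos (lt_of_le_of_ne ht (Ne.symm h0)), Set.mem_Ico,
          Set.mem_ofPred_eq, max_le_iff]
        tauto
      rw [this, Real.volume_Ico, ← ENNReal.ofReal_min]
      congr 1
      rcases le_total c (b.1 - b.2 / t) with h | h
      · rw [max_eq_right h, min_eq_right (by linarith), sub_sub_cancel]
      · rw [max_eq_left h, min_eq_left (by linarith)]

lemma groundLength_splice (hL' : IsLandscape L') (hb : (α, β) ∈ L')
    (ht : 0 ≤ incline (α, β) q) (y : ℕ → Pt) :
    groundLength (splice L' (Set.range y) α) (α, β) q =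
      volume (shadeBases (α, β) (incline (α, β) q) ∩ (fun x : ℝ => proximity (α, β) (x, 0)) ⁻¹'
        Set.Ici (record (proximity (α, β)) (aboveLeft (α, β) (incline (α, β) q)) y)) := by
  rw [shadeBases_inter_proximity, volume_shadeBases_inter ht, groundLength,
    shadowCuttingBase_splice hL' hb]
  simp only [blockageAngle, Real.arctan_eq_zero_iff, Real.tan_arctan]

/-- The mean ground length. -/
lemma lintegral_groundLength {Ω : Type*} [MeasurableSpace Ω] {P : Measure Ω}
    [IsProbabilityMeasure P] {lam : ℝ} {law : Measure ℝ≥0} [IsProbabilityMeasure law]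
    (hL' : IsLandscape L') (hb : (α, β) ∈ L') {Y : ℕ → Ω → Pt}
    (hY : HasPoissonHits P (intensity lam law) Y) (ht : 0 ≤ incline (α, β) q) :
    ∫⁻ ω, groundLength (splice L' (Set.range fun n => Y n ω) α) (α, β) q ∂P =
      ∫⁻ x in shadeBases (α, β) (incline (α, β) q),
        expNeg (ENNReal.ofReal lam * ∫⁻ y in Set.Ioo x α,
          ENNReal.ofReal (tailAlong law (α, β) (incline (α, β) q) y)) := by
  have hκ := measurable_proximity (α, β)
  have hT := measurableSet_aboveLeft (α, β) (incline (α, β) q)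
  simp_rw [groundLength_splice hL' hb ht]
  refine (lintegral_measure_inter_Ici (measurable_record hY.measurable hκ hT)
    (hκ.comp measurable_prodMk_right)).trans ?_
  refine setLIntegral_congr_fun measurableSet_shadeBases fun x hx => ?_
  exact (hY.measure_record_le hκ hT _).trans (congrArg expNeg (intensity_aboveLeft_Ioi lam hx.1))

/-- The mean number of relayed buildings, the mean ground length, and the probability that the
zone is cut. -/
theorem mul_lintegral_groundLength {Ω : Type*} [MeasurableSpace Ω] {P : Measure Ω}
    [IsProbabilityMeasure P] {lam : ℝ} {law : Measure ℝ≥0} [IsProbabilityMeasure law]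
    (hL' : IsLandscape L') (hb : (α, β) ∈ L')
    (hq : IsBlockingBuilding L' (α, β) q) {Y : ℕ → Ω → Pt}
    (hY : HasPoissonHits P (intensity lam law) Y)
    (hgood : ∀ᵐ ω ∂P, IsLocallyFiniteSeq α fun n => Y n ω) (ht : 0 ≤ incline (α, β) q) :
    ENNReal.ofReal lam *
        ∫⁻ ω, groundLength (splice L' (Set.range fun n => Y n ω) α) (α, β) q ∂P =
      ∫⁻ ω, ((relayedBuildings (splice L' (Set.range fun n => Y n ω) α) (α, β)).encard : ℝ≥0∞) ∂P +
      ENNReal.ofReal lam * ∫⁻ x in shadeBases (α, β) (incline (α, β) q),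
        ENNReal.ofReal (tailAlong law (α, β) (incline (α, β) q) x) *
          expNeg (ENNReal.ofReal lam * ∫⁻ y in Set.Ioo x α,
            ENNReal.ofReal (tailAlong law (α, β) (incline (α, β) q) y)) := by
  have hκ := measurable_proximity (α, β)
  have hS := measurableSet_shadeLeft (α, β) (incline (α, β) q)
  have hT := measurableSet_aboveLeft (α, β) (incline (α, β) q)
  have hρ := measurable_record hY.measurable hκ hT
  have hΨ : Measurable fun x : ℝ => P {ω | record (proximity (α, β))
      (aboveLeft (α, β) (incline (α, β) q)) (fun n => Y n ω) ≤ proximity (α, β) (x, 0)} :=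
    measurable_measure_le.comp (hκ.comp measurable_prodMk_right)
  have hE : ∀ x ∈ shadeBases (α, β) (incline (α, β) q),
      expNeg (ENNReal.ofReal lam * ∫⁻ y in Set.Ioo x α,
        ENNReal.ofReal (tailAlong law (α, β) (incline (α, β) q) y)) =
      P {ω | record (proximity (α, β)) (aboveLeft (α, β) (incline (α, β) q))
        (fun n => Y n ω) ≤ proximity (α, β) (x, 0)} := fun x hx =>
    ((hY.measure_record_le hκ hT _).trans
      (congrArg expNeg (intensity_aboveLeft_Ioi lam hx.1))).symm
  have : SFinite (intensity lam law) := by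
    unfold intensity
    infer_instance
  have hcount : ∫⁻ ω, ((relayedBuildings (splice L' (Set.range fun n => Y n ω) α)
      (α, β)).encard : ℝ≥0∞) ∂P = ENNReal.ofReal lam *
        ∫⁻ x in shadeBases (α, β) (incline (α, β) q),
          ENNReal.ofReal (1 - tailAlong law (α, β) (incline (α, β) q) x) *
          P {ω | record (proximity (α, β)) (aboveLeft (α, β) (incline (α, β) q))
            (fun n => Y n ω) ≤ proximity (α, β) (x, 0)} := by
    refine Eq.trans ?_ (((hY.lintegral_hits_record hκ hS hT (disjoint_shadeLeft_aboveLeft _ _)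
      (intensity_shadeLeft_proximity_ne_top lam law _ _)
      (hgood.mono fun ω hω => IsLocallyFiniteSeq.finite_proximity (b := (α, β)) hω)).trans
      (lintegral_measure_inter_Ici hρ hκ)).trans (setLIntegral_shadeLeft lam hΨ))
    refine lintegral_congr_ae ?_
    filter_upwards [hgood] with ω hω
    rw [← encard_relayedBuildings_inter hL' hb hq hω, Set.inter_univ]
  rw [hcount, lintegral_groundLength hL' hb hY ht, ← mul_add]
  congr 1
  refine Eq.trans ?_ (lintegral_add_left
    ((measurable_tailAlong.const_sub 1).ennreal_ofReal.mul hΨ) _)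
  refine setLIntegral_congr_fun measurableSet_shadeBases fun x hx => ?_
  simp only [hE x hx, Pi.mul_apply]
  -- The decomposition 1 = (1 - w) + w splits the integrand of the ground length into the relayed
  -- buildings and the density of the cut.
  rw [← add_mul, ← ENNReal.ofReal_add (sub_nonneg.mpr (tailAlong_le_one x)) (tailAlong_nonneg x)]
  simp

/-- The integral over the left half line of the density of the first point of a homogeneous Poisson
process. -/
lemma mul_lintegral_Iio_expNeg {lam p : ℝ} (hlam : 0 < lam) (hp : 0 < p) (α : ℝ) :
    ENNReal.ofReal lam * ∫⁻ x in Set.Iio α, ENNReal.ofReal p *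
      expNeg (ENNReal.ofReal lam * ∫⁻ _ in Set.Ioo x α, ENNReal.ofReal p) = 1 := by
  have hU : Set.Iio α = ⋃ N : ℕ, Set.Ico (α - N) α := by
    ext x
    simp only [Set.mem_Iio, Set.mem_iUnion, Set.mem_Ico, exists_and_right, iff_and_self]
    intro _
    obtain ⟨N, hN⟩ := exists_nat_ge (α - x)
    exact ⟨N, by linarith⟩
  have hmono : Monotone fun N : ℕ => Set.Ico (α - N) α := fun M N h =>
    Set.Ico_subset_Ico_left (sub_le_sub_left (by exact_mod_cast h) _)
  have hlim : Tendsto (fun N : ℕ => ENNReal.ofReal (1 - Real.exp (-(lam * p * N)))) atTop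
      (𝓝 (ENNReal.ofReal (1 - 0))) := by
    refine ENNReal.tendsto_ofReal (tendsto_const_nhds.sub ?_)
    exact Real.tendsto_exp_neg_atTop_nhds_zero.comp
      (tendsto_natCast_atTop_atTop.const_mul_atTop (mul_pos hlam hp))
  have hsup := tendsto_atTop_iSup (f := fun N : ℕ => ENNReal.ofReal lam *
      ∫⁻ x in Set.Ico (α - N) α, ENNReal.ofReal p *
        expNeg (ENNReal.ofReal lam * ∫⁻ _ in Set.Ioo x α, ENNReal.ofReal p))
    fun M N h => mul_le_mul_right (lintegral_mono_set (hmono h)) _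
  rw [← ENNReal.mul_iSup, ← setLIntegral_iUnion_of_directed _ hmono.directed_le, ← hU] at hsup
  rw [sub_zero, ENNReal.ofReal_one] at hlim
  refine tendsto_nhds_unique hsup (hlim.congr fun N => ?_)
  rw [lintegral_mul_expNeg_lintegral antitone_const (fun _ => hp.le) hlam.le
    (sub_le_self _ N.cast_nonneg), intervalIntegral.integral_const, smul_eq_mul, sub_sub_cancel,
    mul_assoc, mul_comm p]

/-- For a building with horizontal line of sight, the zone is cut almost surely, or else both means
are infinite. -/
theorem lintegral_encard_add_one {Ω : Type*} [MeasurableSpace Ω] {P : Measure Ω}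
    [IsProbabilityMeasure P] {lam : ℝ} (hlam : 0 < lam) {law : Measure ℝ≥0}
    [IsProbabilityMeasure law] (hL' : IsLandscape L') (hb : (α, β) ∈ L')
    (hq : IsBlockingBuilding L' (α, β) q) {Y : ℕ → Ω → Pt}
    (hY : HasPoissonHits P (intensity lam law) Y)
    (hgood : ∀ᵐ ω ∂P, IsLocallyFiniteSeq α fun n => Y n ω) (ht : incline (α, β) q = 0) :
    ∫⁻ ω, ((relayedBuildings (splice L' (Set.range fun n => Y n ω) α) (α, β)).encard : ℝ≥0∞) ∂P
      + 1 = ENNReal.ofReal lam *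
        ∫⁻ ω, groundLength (splice L' (Set.range fun n => Y n ω) α) (α, β) q ∂P := by
  have hw : tailAlong law (α, β) (incline (α, β) q) = fun _ => law.real {h : ℝ≥0 | (β : ℝ) < h} := by
    funext x
    simp [tailAlong, ht]
  have key := mul_lintegral_groundLength hL' hb hq hY hgood ht.ge
  have hlen := lintegral_groundLength (lam := lam) (law := law) (q := q) hL' hb hY ht.ge
  rw [hw, shadeBases_of_eq_zero ht] at key hlen
  -- If almost no building is higher than β, the probability of remaining uncut is 1 at every x < α
  -- and both means are infinite. Otherwise the cutting buildings form a process of constant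
  -- positive intensity and the density of the cut has total mass 1.
  rcases (measureReal_nonneg (μ := law) (s := {h : ℝ≥0 | (β : ℝ) < h})).eq_or_lt with hp | hp
  · simp only [← hp, ENNReal.ofReal_zero, lintegral_zero, mul_zero, zero_mul, expNeg_zero,
      add_zero, lintegral_one, Measure.restrict_apply_univ, Real.volume_Iio] at key hlen
    rw [hlen, ENNReal.mul_top (ENNReal.ofReal_pos.mpr hlam).ne'] at key ⊢
    rw [← key, top_add]
  · rw [key, mul_lintegral_Iio_expNeg hlam hp]

end GroundLength

/-! ### The tail integral of the height distribution -/

section Tail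

variable {law : Measure ℝ≥0} [IsProbabilityMeasure law]

lemma one_sub_heightCDF (s : ℝ) : 1 - heightCDF law s = law.real {h : ℝ≥0 | s < h} := by
  have hm : MeasurableSet {h : ℝ≥0 | (h : ℝ) ≤ s} :=
    measurableSet_le (by fun_prop) measurable_const
  rw [heightCDF, ← probReal_compl_eq_one_sub hm]
  congr 1
  ext h
  simp

/-- Layer cake: the integral of the tail is the mean height. -/
lemma integrableOn_one_sub_heightCDF (hlaw : Integrable (fun h : ℝ≥0 => (h : ℝ)) law) :
    IntegrableOn (fun s => 1 - heightCDF law s) (Set.Ioi 0) := by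
  simp_rw [one_sub_heightCDF]
  have hanti : Antitone fun s : ℝ => law.real {h : ℝ≥0 | s < h} := fun s r hsr =>
    measureReal_mono fun h hh => lt_of_le_of_lt hsr hh
  refine ⟨hanti.measurable.aestronglyMeasurable, ?_⟩
  have h1 : ∀ s : ℝ, ‖law.real {h : ℝ≥0 | s < h}‖ₑ = law {h : ℝ≥0 | s < h} := fun s => by
    rw [Real.enorm_of_nonneg measureReal_nonneg, ofReal_measureReal]
  rw [HasFiniteIntegral]
  simp_rw [h1]
  rw [← lintegral_eq_lintegral_meas_lt law (f := fun h : ℝ≥0 => (h : ℝ))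
    (Eventually.of_forall fun h => h.2)
    hlaw.aemeasurable]
  exact hlaw.lintegral_lt_top

lemma primitiveTail_sub (hlaw : Integrable (fun h : ℝ≥0 => (h : ℝ)) law) {β : ℝ} (hβ : 0 ≤ β) :
    primitiveTail law β - primitiveTail law 0 = ∫ s in (0 : ℝ)..β, (1 - heightCDF law s) := by
  rw [← intervalIntegral.integral_Ioi_sub_Ioi (integrableOn_one_sub_heightCDF hlaw) hβ,
    primitiveTail, primitiveTail]
  ring

/-- The substitution s = β - t(α - x) follows the line of slope t from the ground, at the foot of
the shade, up to the height β at b. -/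
lemma integral_tailAlong (b : Pt) {t : ℝ} (ht : 0 < t) :
    ∫ x in (b.1 - b.2 / t)..b.1, tailAlong law b t x
      = t⁻¹ * ∫ s in (0 : ℝ)..b.2, (1 - heightCDF law s) := by
  have h1 : ∀ x, tailAlong law b t x
      = 1 - heightCDF law (((b.2 : ℝ) - t * b.1) + t * x) := by
    intro x
    rw [one_sub_heightCDF, tailAlong]
    congr 3
    ext h
    ring_nf
  have h2 := intervalIntegral.integral_comp_add_mul (a := b.1 - b.2 / t) (b := b.1)
    (fun s => 1 - heightCDF law s) ht.ne' ((b.2 : ℝ) - t * b.1)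
  rw [show (b.2 : ℝ) - t * b.1 + t * (b.1 - b.2 / t) = 0 by field_simp; ring,
    show (b.2 : ℝ) - t * b.1 + t * b.1 = b.2 by ring, smul_eq_mul] at h2
  simpa only [h1] using h2

end Tail

end LoS

end

theorem mainTheorem8 {Ω : Type*} [MeasurableSpace Ω] (P : MeasureTheory.Measure Ω)
    [MeasureTheory.IsProbabilityMeasure P]
    (lam : ℝ) (hlam : 0 < lam)
    (law : MeasureTheory.Measure ℝ≥0) [MeasureTheory.IsProbabilityMeasure law]
    (hlaw : MeasureTheory.Integrable (fun h : ℝ≥0 => (h : ℝ)) law)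
    (L : Ω → Set LoS.Pt) (hL : LoS.IsPoissonBuildingProcess P lam law L)
    (L' : Set LoS.Pt) (hL' : LoS.IsLandscape L')
    (α : ℝ) (β : ℝ≥0) (hb : (α, β) ∈ L')
    (q : LoS.Pt) (hq : LoS.IsBlockingBuilding L' (α, β) q)
    (θ : ℝ) (hθ : θ = LoS.blockageAngle (α, β) q)
    (Lt : Ω → Set LoS.Pt) (hLt : ∀ ω, Lt ω = LoS.splice L' (L ω) α) :
    LoS.IsCondPoissonProcess P (LoS.sigmaOf fun ω => LoS.zone (Lt ω) (α, β))
        (fun ω => (LoS.intensity lam law).restrict (LoS.zone (Lt ω) (α, β)))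
        (fun ω => LoS.relayedBuildings (Lt ω) (α, β)) ∧
    (0 < θ →
      ∫⁻ ω, ((LoS.relayedBuildings (Lt ω) (α, β)).encard : ℝ≥0∞) ∂P ≠ ⊤ ∧
      ∫⁻ ω, LoS.groundLength (Lt ω) (α, β) q ∂P ≠ ⊤ ∧
      (∫⁻ ω, ((LoS.relayedBuildings (Lt ω) (α, β)).encard : ℝ≥0∞) ∂P).toReal =
        lam * (∫⁻ ω, LoS.groundLength (Lt ω) (α, β) q ∂P).toReal
          - (1 - Real.exp (-(lam / Real.tan θ) *
              (LoS.primitiveTail law (β : ℝ) - LoS.primitiveTail law 0)))) ∧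
    (θ = 0 →
      ∫⁻ ω, ((LoS.relayedBuildings (Lt ω) (α, β)).encard : ℝ≥0∞) ∂P + 1 =
        ENNReal.ofReal lam * ∫⁻ ω, LoS.groundLength (Lt ω) (α, β) q ∂P) := by
  obtain ⟨Y, hLY, hY, hgood⟩ := hL.exists_seq α
  obtain rfl : Lt = fun ω => LoS.splice L' (Set.range fun n => Y n ω) α :=
    funext fun ω => by rw [hLt, hLY]
  refine ⟨LoS.isCondPoissonProcess_relayedBuildings hL' hb hq hY hgood, fun hpos => ?_,
    fun hzero => ?_⟩
  · have ht : 0 < LoS.incline (α, β) q := by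
      rwa [hθ, LoS.blockageAngle, Real.arctan_pos] at hpos
    have htan : Real.tan θ = LoS.incline (α, β) q := by
      rw [hθ, LoS.blockageAngle, Real.tan_arctan]
    have key := LoS.mul_lintegral_groundLength hL' hb hq hY hgood ht.le
    have hc : α - (β : ℝ) / LoS.incline (α, β) q ≤ α := sub_le_self _ (div_nonneg β.2 ht.le)
    rw [LoS.shadeBases_of_pos ht, LoS.lintegral_mul_expNeg_lintegral
      (LoS.antitone_tailAlong ht.le) LoS.tailAlong_nonneg hlam.le hc,
      LoS.integral_tailAlong (α, β) ht] at key
    simp only [] at key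
    rw [← LoS.primitiveTail_sub hlaw β.coe_nonneg] at key
    -- For t > 0 the ground length never exceeds β / t; finiteness of the mean number of buildings
    -- then follows from `key`, where it is one summand of a finite quantity.
    have hground : ∫⁻ ω, LoS.groundLength (LoS.splice L' (Set.range fun n => Y n ω) α)
        (α, β) q ∂P ≠ ⊤ := by
      refine ne_top_of_le_ne_top (b := ENNReal.ofReal (β / LoS.incline (α, β) q))
        ENNReal.ofReal_ne_top ?_
      calc ∫⁻ ω, LoS.groundLength (LoS.splice L' (Set.range fun n => Y n ω) α) (α, β) q ∂P
          ≤ ∫⁻ _, ENNReal.ofReal (β / LoS.incline (α, β) q) ∂P := by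
            refine lintegral_mono fun ω => (min_le_right _ _).trans ?_
            rw [if_neg (hθ ▸ hpos.ne'), ← hθ, htan]
        _ = _ := by simp
    have hcount : ∫⁻ ω, ((LoS.relayedBuildings (LoS.splice L' (Set.range fun n => Y n ω) α)
        (α, β)).encard : ℝ≥0∞) ∂P ≠ ⊤ :=
      ne_top_of_le_ne_top (ENNReal.mul_ne_top ENNReal.ofReal_ne_top hground)
        (le_self_add.trans key.ge)
    refine ⟨hcount, hground, ?_⟩
    -- Nonnegativity ensures that `ENNReal.ofReal` does not truncate this term when `key` is
    -- converted to real numbers.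
    have hexp : 0 ≤ 1 - Real.exp (-(lam * ((LoS.incline (α, β) q)⁻¹ *
        (LoS.primitiveTail law β - LoS.primitiveTail law 0)))) := by
      rw [sub_nonneg, Real.exp_le_one_iff, neg_nonpos, LoS.primitiveTail_sub hlaw β.coe_nonneg]
      refine mul_nonneg hlam.le (mul_nonneg (inv_pos.mpr ht).le
        (intervalIntegral.integral_nonneg β.coe_nonneg fun s _ => ?_))
      rw [LoS.one_sub_heightCDF]
      exact measureReal_nonneg
    have := congrArg ENNReal.toReal key
    rw [ENNReal.toReal_mul, ENNReal.toReal_ofReal hlam.le,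
      ENNReal.toReal_add hcount ENNReal.ofReal_ne_top, ENNReal.toReal_ofReal hexp] at this
    rw [this, htan, add_sub_assoc]
    rw [show -(lam / LoS.incline (α, β) q) * (LoS.primitiveTail law β - LoS.primitiveTail law 0)
      = -(lam * ((LoS.incline (α, β) q)⁻¹ *
        (LoS.primitiveTail law β - LoS.primitiveTail law 0))) by ring, sub_self, add_zero]
  · have ht : LoS.incline (α, β) q = 0 := by
      rwa [hθ, LoS.blockageAngle, Real.arctan_eq_zero_iff] at hzero
    exact LoS.lintegral_encard_add_one hlam hL' hb hq hY hgood ht
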